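/- **Setting.** Fix predicate symbols with arities and a nonempty set $D$ of constants, the only function symbols; there is no equality. *Clauses* are finite multisets (disjunctions) of literals; $\bot$ is the empty clause; $\neg L$ is the complement and $|L|$ the atom of a literal $L$; $\mathrm{gnd}(C)$ is the set of ground instances of $C$ over $D$, and $\mathrm{gnd}(M)=\bigcup_{C\in M}\mathrm{gnd}(C)$. Interpretations are sets of ground atoms; $I\models C$ means that $I$ satisfies every element of $\mathrm{gnd}(C)$, and $\models$ between clause sets and clauses is consequence over these interpretations. Distinct expressions are renamed to be variable disjoint wherever needed. **Constraints.** A *constraint* $\pi$ is $\bot$ or a finite conjunction of disequations $\vec s_i\neq\vec t_i$ between tuples of terms of equal length, the variables of $\vec t_i$ being local to the disequation ($\top$ is the empty conjunction). A ground substitution $\delta$ is a *solution* of $\pi$ if no $\vec s_i\delta$ is an instance of $\vec t_i$; $\bot$ has no solution. Substitutions act on left-hand sides only. Constraints are *equivalent* if they have the same solutions; a constraint computed by a rule may be replaced by an equivalent one (normalization). $\mathrm{gnd}(E;\pi)=\{E\delta : \delta \text{ a solution of }\pi\}$ for a literal or clause $E$; $(E;\pi)$ is *empty* if this set is. A *constrained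 literal* is a pair $(L;\pi)$ in which all left-hand side variables of $\pi$ occur in $L$. **Trails.** A *trail* $\Gamma$ is a finite sequence of constrained literals, each either a *decision* $(L;\pi)^i$ annotated with its level $i\ge 1$, or a *deduced* literal $(L\cdot\sigma;\pi)^{C\vee L}$, which stands for $(L\sigma;\pi)$, annotated with a reason clause. An element with constrained literal $(K;\pi)$ *defines* the atoms of $\mathrm{gnd}(|K|;\pi)$. A ground literal is *false* under $\Gamma$ if its complement is covered by (is in $\mathrm{gnd}$ of) an element of $\Gamma$; a ground clause is false if all its literals are; $(C;\pi)$ is false if all elements of $\mathrm{gnd}(C;\pi)$ are; $(L;\pi)$ is *undefined* if no atom of $\mathrm{gnd}(|L|;\pi)$ is defined by $\Gamma$. $I_\Gamma$ is the set of ground atoms covered by the positive elements of $\Gamma$. The level of a defined ground literal is that of the last decision up to and including the element defining it ($0$ if none); the top-level $\mathrm{lvl}(\Gamma)$ is the largest level of a decision in $\Gamma$ ($0$ if none). A ground clause is *assertive* if it is false and contains exactly one occurrence of a top-level literal; $(C;\pi)$ is assertive if some element of $\mathrm{gnd}(C;\pi)$ is. An undefined decision $(L;\pi)$ is *blocked*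 in $\Gamma$ by $C$ if some $G\in\mathrm{gnd}(C)$ is false under $\Gamma,(L;\pi)$ and contains literals $L_1\neq L_2$ with $\neg L_1,\neg L_2\in\mathrm{gnd}(L;\pi)$. **Rules.** States are $(\Gamma;N;U;k;s)$ with clause sets $N$ (input) and $U$ (learned), $k\in\mathbb Z$, and $s$ one of $\top$, $\bot$, $(C;\sigma;\pi)$. *Conflict search* (from $s=\top$; every rule but Failure also requires $k\ge0$): * *Propagate*: append $(L\cdot\sigma;\pi)^{C\vee L}$ if $C\vee L\in N\cup U$, $(C\sigma;\pi)$ is false under $\Gamma$, and the constrained literal $(L\sigma;\pi)$ is undefined in $\Gamma$ and not empty. * *Decide*: append $(L;\pi)^{k+1}$ and increase $k$ by one, if the constrained literal $(L;\pi)$ is undefined, not blocked in $\Gamma$ by any clause of $N\cup U$, not empty, and $|L|$ is an instance of an atom occurring in $N$. * *Conflict*: set $s:=(C;\sigma;\pi)$ if $\bot\ne C\in N\cup U$ and $(C\sigma;\pi)$ is false under $\Gamma$ and not empty. * *Success*: set $k:=-1$ if $I_\Gamma\models N$. *Failure*: set $k:=0$, $s:=\bot$ if $\bot\in N\cup U$.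 *Conflict resolution* (from $s=(\cdot;\sigma;\pi)$): * *Skip*, with $s=(C;\sigma;\pi)$: remove the last trail element if it is a deduced literal $(L'\cdot\sigma';\pi')$ and there is no $L\in C$ such that $\eta=\mathrm{mgu}(L'\sigma',\neg L\sigma)$ exists and $(C\sigma\eta;\pi\eta\wedge\pi'\eta)$ is not empty. * *Resolve*, with $s=(C\vee L;\sigma;\pi)$ and last element $(L'\cdot\sigma';\pi')^{C'\vee L'}$: set $s:=((C\vee C')\eta_0;\sigma^*;\pi\eta\wedge\pi'\eta)$, if $((C\vee L)\sigma;\pi)$ is not assertive or $k=0$, $\eta=\mathrm{mgu}(L'\sigma',\neg L\sigma)$ exists, $\eta_0=\mathrm{mgu}(L',\neg L)$, $\eta_0\sigma^*$ equals $\sigma\eta$ on the variables of $C\vee L$ and $\sigma'\eta$ on those of $C'\vee L'$, and $((C\vee L)\sigma\eta;\pi\eta\wedge\pi'\eta)$ is not empty. * *Factorize*, with $s=(C\vee L_1\vee L_2;\sigma;\pi)$ and last element (of either kind) with constrained literal $(K;\pi')$: set $s:=((C\vee L_1)\eta_0;\sigma^*;\pi\eta)$, if $\eta=\mathrm{mgu}\{L_1\sigma,L_2\sigma,\neg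 K\}$ exists, $\eta_0=\mathrm{mgu}(L_1,L_2)$, $\eta_0\sigma^*=\sigma\eta$ on the variables of $C\vee L_1\vee L_2$, and $((C\vee L_1)\sigma\eta;\pi\eta\wedge\pi'\eta)$ is not empty. * *Backjump*: $(\Gamma_1,\Gamma_2;N;U;k;(C;\sigma;\pi))\Rightarrow(\Gamma_1;N;U\cup\{C\};k';\top)$ if $k'=\mathrm{lvl}(\Gamma_1)$, $0\le k'\le k$, and (1) $k=0$ and $C=\bot$; or (2) $k>0$, $(C\sigma;\pi)$ is assertive, and $C$ has no ground instance that is false under $\Gamma_1$; or (3) $k>0$, the last element of $\Gamma_2$ is the top-level decision, $(C\sigma;\pi)$ is not assertive, Factorize is not applicable, and $C$ has no ground instance that is false under $\Gamma_1$. The clause $C$ is said to be *learned*. **Regular runs.** A state $(\Gamma;N;U;k;s)$ is *sound* if: distinct elements of $\Gamma$ define disjoint sets of atoms; if $k\ge 0$, $\Gamma$ contains exactly $k$ decisions; each level $1,\dots,k$ occurs exactly once, and decisions occur in order of their levels; each decision of $\Gamma$ satisfies the conditions of Decide, and each deduced literal those of Propagate, with respect to the part of $\Gamma$ before it and $N,U$;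 $N\models U$; $s=\bot$ implies $\bot\in N\cup U$; $k=-1$ implies $I_\Gamma\models N$; and if $s=(C;\sigma;\pi)$ then $(C\sigma;\pi)$ is false under $\Gamma$ and not empty, and $N\models C$. A sound state is *regular* if, whenever $\Gamma=\Gamma',\ell$ with last element $\ell$, no clause of $N\cup U$ has a ground instance that is false under $\Gamma'$, and, whenever $\Gamma=\Gamma_1,(L;\pi)^i,\Gamma_2$ with a decision $(L;\pi)^i$, Propagate has no instance with respect to $\Gamma_1$ and $N\cup U$. A *regular run* is a finite or infinite sequence of states, each obtained from the previous one by a rule, that starts in a regular state (for instance the initial state $(\varepsilon;N;\emptyset;0;\top)$), such that during conflict search a rule is applied only if no rule earlier in the order "Failure and Success; Conflict; Propagate; Decide" is applicable (or, throughout the run, with the order "Failure; Conflict; Propagate; Decide; Success" instead), Skip, Resolve and Factorize are applied only if Backjump is not applicable, and every Backjump leads to a regular state. **Induced ordering.** Let $<$ be a well-founded strict total ordering on ground atoms. For a trail $\Gamma$ and a ground atom $P$ let $\mathrm{def}(P)$ be the element of $\Gamma$ that defines $P$, or an extra symbol $\bot$ if there is none. Elements of $\Gamma$ are ordered by position in $\Gamma$,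 with $\bot$ as largest; this is $<_p$. Put $P<_\Gamma Q$ iff $\mathrm{def}(P)<_p\mathrm{def}(Q)$, or $\mathrm{def}(P)=\mathrm{def}(Q)$ and $P<Q$. An ordering on (abstract or ground) atoms is extended to literals by comparing the atoms first and putting an atom before its negation, and to clauses by the multiset extension; $\mathrm{def}$ is extended to ground literals preserving polarity, and to ground clauses as multisets. For ground clauses, $G<_\Gamma H$ iff $\mathrm{def}(G)<_p\mathrm{def}(H)$, or $\mathrm{def}(G)=\mathrm{def}(H)$ and $G$ is smaller than $H$ in the multiset extension of the literal ordering $<_\Gamma$. **Redundancy.** A ground clause $G$ is *redundant* w.r.t. a set $M$ of ground clauses and $<_\Gamma$ if $G\in M$ or there is $T\subseteq\{H\in M: H<_\Gamma G\}$ with $T\models G$. A clause $C$ is redundant w.r.t. a clause set $M$ and $<_\Gamma$ if every $G\in\mathrm{gnd}(C)$ is redundant w.r.t. $\mathrm{gnd}(M)$ and $<_\Gamma$. **Theorem (Non-redundant clause learning).** Consider a regular run. Suppose that the rule Conflict is applied in a state with trail $\Gamma$, input clause set $N$ and set of learned clauses $U$, and that the first application of Backjump after it learns the clause $C$. Then $C$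 is not redundant with respect to $N\cup U$ and $<_\Gamma$; that is, some ground instance of $C$ is neither in $\mathrm{gnd}(N\cup U)$ nor a consequence of elements of $\mathrm{gnd}(N\cup U)$ that are smaller than it with respect to $<_\Gamma$. -/

import Mathlib

universe u v

namespace NRCL

/-! ### Function-free first-order syntax -/

/-- A signature of the Bernays-Schoenfinkel fragment: predicate symbols with arities, and
constant symbols, which are the only function symbols. -/
structure Signature where
  Pred : Type u
  arity : Pred → ℕ
  Const : Type v

/-- Terms: variables are natural numbers. -/
inductive Term (S : Signature.{u, v}) where
  | var (x : ℕ) : Term S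
  | const (c : S.Const) : Term S

/-- Atoms with arguments of type `α`: first-order atoms for `α = Term S`, ground atoms for
`α = S.Const`. -/
structure Atom (S : Signature.{u, v}) (α : Type v) where
  pred : S.Pred
  args : Fin (S.arity pred) → α

/-- Literals over atoms of type `A`; `pos` is the polarity. -/
structure Lit (A : Type*) where
  pos : Bool
  atom : A

/-- The complement of a literal. -/
def Lit.neg {A : Type*} (L : Lit A) : Lit A := ⟨!L.pos, L.atom⟩

abbrev GAtom (S : Signature.{u, v}) := Atom S S.Const
abbrev Literal (S : Signature.{u, v}) := Lit (Atom S (Term S))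
abbrev GLiteral (S : Signature.{u, v}) := Lit (GAtom S)

/-- Clauses are finite multisets of literals; the empty clause is `0`. -/
abbrev Clause (S : Signature.{u, v}) := Multiset (Literal S)
abbrev GClause (S : Signature.{u, v}) := Multiset (GLiteral S)

def litMap {S : Signature.{u, v}} {α β : Type v} (f : α → β) (L : Lit (Atom S α)) :
    Lit (Atom S β) :=
  ⟨L.pos, ⟨L.atom.pred, fun i => f (L.atom.args i)⟩⟩

/-- Substitutions. -/
abbrev Subst (S : Signature.{u, v}) := ℕ → Term S

section Basics

variable {S : Signature.{u, v}}

def Term.subst (σ : Subst S) : Term S → Term S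
  | .var x => σ x
  | .const c => .const c

/-- The value of a term under a ground substitution. -/
def Term.ground (δ : ℕ → S.Const) : Term S → S.Const
  | .var x => δ x
  | .const c => c

def litSubst (σ : Subst S) (L : Literal S) : Literal S := litMap (Term.subst σ) L
def clauseSubst (σ : Subst S) (C : Clause S) : Clause S := C.map (litSubst σ)
def litGround (δ : ℕ → S.Const) (L : Literal S) : GLiteral S := litMap (Term.ground δ) L
def clauseGround (δ : ℕ → S.Const) (C : Clause S) : GClause S := C.map (litGround δ)

def litVars (L : Literal S) : Set ℕ := {x | ∃ i, L.atom.args i = Term.var x}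
def clauseVars (C : Clause S) : Set ℕ := {x | ∃ L ∈ C, x ∈ litVars L}

/-- The substitution that renames variables by the permutation `ρ`. -/
def permSubst (S : Signature.{u, v}) (ρ : Equiv.Perm ℕ) : Subst S := fun x => Term.var (ρ x)

/-- `η` is a most general unifier of the literals in `E`. -/
def IsMGU (η : Subst S) (E : Set (Literal S)) : Prop :=
  (∀ K ∈ E, ∀ L ∈ E, litSubst η K = litSubst η L) ∧
  ∀ θ : Subst S, (∀ K ∈ E, ∀ L ∈ E, litSubst θ K = litSubst θ L) →
    ∃ τ : Subst S, ∀ x, θ x = (η x).subst τ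

end Basics

/-! ### Semantics of clauses -/

section Semantics

variable {S : Signature.{u, v}}

/-- The ground instances of a clause. -/
def gnd (C : Clause S) : Set (GClause S) := {G | ∃ δ : ℕ → S.Const, G = clauseGround δ C}

/-- The ground instances of a set of clauses. -/
def gndSet (M : Set (Clause S)) : Set (GClause S) := {G | ∃ C ∈ M, G ∈ gnd C}

/-- Satisfaction of a ground literal in an interpretation, given as its set of true atoms. -/
def SatLit (I : Set (GAtom S)) (L : GLiteral S) : Prop := L.pos = true ↔ L.atom ∈ I

def SatG (I : Set (GAtom S)) (G : GClause S) : Prop := ∃ L ∈ G, SatLit I L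

def Sat (I : Set (GAtom S)) (C : Clause S) : Prop := ∀ G ∈ gnd C, SatG I G

/-- Consequence between clauses. -/
def Entails (M : Set (Clause S)) (C : Clause S) : Prop :=
  ∀ I : Set (GAtom S), (∀ D ∈ M, Sat I D) → Sat I C

/-- Consequence between ground clauses. -/
def GEntails (M : Set (GClause S)) (G : GClause S) : Prop :=
  ∀ I : Set (GAtom S), (∀ H ∈ M, SatG I H) → SatG I G

end Semantics

/-! ### Dismatching constraints -/

/-- An atomic constraint: a disequation between two tuples of terms of the same dimension. The
variables of the right-hand side are local to the disequation: they live in a name space of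
their own, and substitutions act on the left-hand side only. -/
structure Diseq (S : Signature.{u, v}) where
  dim : ℕ
  lhs : Fin dim → Term S
  rhs : Fin dim → Term S

/-- A dismatching constraint: the unsatisfiable one, or a finite conjunction of disequations. -/
inductive Constraint (S : Signature.{u, v}) where
  | bot : Constraint S
  | conj (l : List (Diseq S)) : Constraint S

section Constraints

variable {S : Signature.{u, v}}

/-- The tautological constraint. -/
def Constraint.top : Constraint S := .conj []

def Constraint.and : Constraint S → Constraint S → Constraint S
  | .conj l, .conj l' => .conj (l ++ l')
  | _, _ => .bot

def Diseq.subst (σ : Subst S) (d : Diseq S) : Diseq S :=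
  ⟨d.dim, fun i => (d.lhs i).subst σ, d.rhs⟩

def Constraint.subst (σ : Subst S) : Constraint S → Constraint S
  | .bot => .bot
  | .conj l => .conj (l.map (Diseq.subst σ))

/-- The left-hand side variables of a constraint. -/
def Constraint.lvars : Constraint S → Set ℕ
  | .bot => ∅
  | .conj l => {x | ∃ d ∈ l, ∃ i, d.lhs i = Term.var x}

/-- `δ` solves `s ≠ t` if the tuple `sδ` is not an instance of the tuple `t`. -/
def Diseq.Solves (δ : ℕ → S.Const) (d : Diseq S) : Prop :=
  ¬ ∃ ε : ℕ → S.Const, ∀ i, (d.lhs i).ground δ = (d.rhs i).ground ε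

/-- Solutions of a constraint. -/
def Constraint.Solves (δ : ℕ → S.Const) : Constraint S → Prop
  | .bot => False
  | .conj l => ∀ d ∈ l, d.Solves δ

/-- Two constraints are equivalent if they have the same solutions. -/
def Constraint.Equivalent (π π' : Constraint S) : Prop :=
  ∀ δ : ℕ → S.Const, π.Solves δ ↔ π'.Solves δ

/-- The side condition on constrained literals `(L; π)`. -/
def IsConstrainedLiteral (L : Literal S) (π : Constraint S) : Prop := π.lvars ⊆ litVars L

/-- The ground literals covered by the constrained literal `(L; π)`. -/
def gndLit (L : Literal S) (π : Constraint S) : Set (GLiteral S) :=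
  {K | ∃ δ : ℕ → S.Const, π.Solves δ ∧ K = litGround δ L}

/-- The ground clauses covered by the constrained clause `(C; π)`. Variables that occur in `π`
but not in `C` are existential. -/
def gndClause (C : Clause S) (π : Constraint S) : Set (GClause S) :=
  {G | ∃ δ : ℕ → S.Const, π.Solves δ ∧ G = clauseGround δ C}

end Constraints

/-! ### Trails -/

/-- An element of a trail: a decision `(L; π)^i`, or a deduced literal `(L·σ; π)` annotated with
its reason clause `C ∨ L`. -/
inductive Entry (S : Signature.{u, v}) where
  | decision (L : Literal S) (π : Constraint S) (i : ℕ) : Entry S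
  | deduced (C : Clause S) (L : Literal S) (σ : Subst S) (π : Constraint S) : Entry S

/-- Trails; the right-most (last) element is the most recent one. -/
abbrev Trail (S : Signature.{u, v}) := List (Entry S)

section Trails

variable {S : Signature.{u, v}}

/-- The literal of a trail element; a closure `L·σ` stands for `Lσ`. -/
def Entry.lit : Entry S → Literal S
  | .decision L _ _ => L
  | .deduced _ L σ _ => litSubst σ L

def Entry.constr : Entry S → Constraint S
  | .decision _ π _ => π
  | .deduced _ _ _ π => π

/-- The ground literals covered by a trail element. -/
def Entry.covered (e : Entry S) : Set (GLiteral S) := gndLit e.lit e.constr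

/-- The trail element defines the ground atom `A`. -/
def Entry.Defines (e : Entry S) (A : GAtom S) : Prop := ∃ K ∈ e.covered, K.atom = A

/-- The level of a decision. -/
def Entry.level? : Entry S → Option ℕ
  | .decision _ _ i => some i
  | .deduced _ _ _ _ => none

/-- The variables of the instance that a trail element stands for: those of `L` and `π`, or of
`(C ∨ L)σ` and `π`. -/
def Entry.instVars : Entry S → Set ℕ
  | .decision L π _ => litVars L ∪ π.lvars
  | .deduced C L σ π => clauseVars (clauseSubst σ (L ::ₘ C)) ∪ π.lvars

/-- Renaming all variables of a trail element by a permutation. -/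
def Entry.rename (ρ : Equiv.Perm ℕ) : Entry S → Entry S
  | .decision L π i => .decision (litSubst (permSubst S ρ) L) (π.subst (permSubst S ρ)) i
  | .deduced C L σ π =>
      .deduced (clauseSubst (permSubst S ρ) C) (litSubst (permSubst S ρ) L)
        (fun x => (σ (ρ.symm x)).subst (permSubst S ρ)) (π.subst (permSubst S ρ))

/-- `e` is a variant of `e₀`. -/
def Entry.IsVariant (e e₀ : Entry S) : Prop := ∃ ρ : Equiv.Perm ℕ, e = e₀.rename ρ

/-- Distinct elements of the trail define disjoint sets of atoms. -/
def StronglyConsistent (Γ : Trail S) : Prop :=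
  Γ.Pairwise fun e e' => ∀ A : GAtom S, ¬ (e.Defines A ∧ e'.Defines A)

/-- The interpretation induced by the positive literals of a trail. -/
def inducedInterp (Γ : Trail S) : Set (GAtom S) :=
  {A | ∃ e ∈ Γ, (⟨true, A⟩ : GLiteral S) ∈ e.covered}

def DefinedAtom (Γ : Trail S) (A : GAtom S) : Prop := ∃ e ∈ Γ, e.Defines A

/-- The ground literal `K` is false under `Γ`. -/
def FalseLit (Γ : Trail S) (K : GLiteral S) : Prop := ∃ e ∈ Γ, K.neg ∈ e.covered

/-- The ground clause `G` is false under `Γ`. -/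
def FalseG (Γ : Trail S) (G : GClause S) : Prop := ∀ K ∈ G, FalseLit Γ K

/-- The constrained clause `(C; π)` is false under `Γ`. -/
def FalseClause (Γ : Trail S) (C : Clause S) (π : Constraint S) : Prop :=
  ∀ G ∈ gndClause C π, FalseG Γ G

/-- The clause `C` has a false instance under `Γ`. -/
def HasFalseInstance (Γ : Trail S) (C : Clause S) : Prop := ∃ G ∈ gnd C, FalseG Γ G

/-- The constrained literal `(L; π)` is undefined in `Γ`. -/
def UndefinedLit (Γ : Trail S) (L : Literal S) (π : Constraint S) : Prop :=
  ∀ K ∈ gndLit L π, ¬ DefinedAtom Γ K.atom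

/-- The levels of the decisions of a trail, from left to right. -/
def decisionLevels (Γ : Trail S) : List ℕ := Γ.filterMap Entry.level?

/-- The level of the last decision of a trail, zero if there is none. -/
def lastLevel (Γ : Trail S) : ℕ := (decisionLevels Γ).getLast?.getD 0

/-- The level of a trail, also called its top-level: the largest level that occurs. -/
def trailLevel (Γ : Trail S) : ℕ := (decisionLevels Γ).foldr max 0

/-- The ground literal `K` is defined in `Γ` and has level `n`. -/
def LitHasLevel (Γ : Trail S) (K : GLiteral S) (n : ℕ) : Prop :=
  ∃ (Γ₁ Γ₂ : Trail S) (e : Entry S), Γ = Γ₁ ++ e :: Γ₂ ∧ e.Defines K.atom ∧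
    lastLevel (Γ₁ ++ [e]) = n

/-- The ground clause `G` is assertive: false, with exactly one (occurrence of a) literal of
top-level. -/
def AssertiveG (Γ : Trail S) (G : GClause S) : Prop :=
  FalseG Γ G ∧ ∃ (K : GLiteral S) (G' : GClause S), G = K ::ₘ G' ∧
    LitHasLevel Γ K (trailLevel Γ) ∧ ∀ K' ∈ G', ¬ LitHasLevel Γ K' (trailLevel Γ)

/-- The constrained clause `(C; π)` is assertive. -/
def Assertive (Γ : Trail S) (C : Clause S) (π : Constraint S) : Prop :=
  ∃ G ∈ gndClause C π, AssertiveG Γ G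

/-- The decision `(L; π)` is blocked in `Γ` by the clause `C`. -/
def BlockedBy (Γ : Trail S) (L : Literal S) (π : Constraint S) (C : Clause S) : Prop :=
  UndefinedLit Γ L π ∧
  ∃ G ∈ gnd C, ∃ K₁ ∈ G, ∃ K₂ ∈ G,
    (∀ K ∈ G, FalseLit Γ K ∨ K.neg ∈ gndLit L π) ∧
    K₁.neg ∈ gndLit L π ∧ K₂.neg ∈ gndLit L π ∧ K₁ ≠ K₂

end Trails

/-! ### States and rules -/

/-- State indicators. -/
inductive Indicator (S : Signature.{u, v}) where
  | top : Indicator S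
  | bot : Indicator S
  | conflict (C : Clause S) (σ : Subst S) (π : Constraint S) : Indicator S

/-- States `(Γ; N; U; k; s)`. -/
structure State (S : Signature.{u, v}) where
  trail : Trail S
  N : Set (Clause S)
  U : Set (Clause S)
  k : ℤ
  ind : Indicator S

section Rules

variable {S : Signature.{u, v}}

/-- The conditions of the rule Propagate for the literal `(L·σ; π)` with reason `C ∨ L`. -/
def PropagateCond (Γ : Trail S) (N U : Set (Clause S)) (C : Clause S) (L : Literal S)
    (σ : Subst S) (π : Constraint S) : Prop :=
  (L ::ₘ C) ∈ N ∪ U ∧ IsConstrainedLiteral (litSubst σ L) π ∧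
  FalseClause Γ (clauseSubst σ C) π ∧ UndefinedLit Γ (litSubst σ L) π ∧
  (gndLit (litSubst σ L) π).Nonempty

/-- The conditions of the rule Decide for the literal `(L; π)`. -/
def DecideCond (Γ : Trail S) (N U : Set (Clause S)) (L : Literal S) (π : Constraint S) : Prop :=
  IsConstrainedLiteral L π ∧ UndefinedLit Γ L π ∧ (∀ C ∈ N ∪ U, ¬ BlockedBy Γ L π C) ∧
  (gndLit L π).Nonempty ∧
  ∃ C ∈ N, ∃ L' ∈ C, ∃ δ : Subst S, L.atom = (litSubst δ L').atom

inductive Propagate : State S → State S → Prop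
  | mk (Γ : Trail S) (N U : Set (Clause S)) (k : ℤ) (C : Clause S) (L : Literal S)
      (σ : Subst S) (π : Constraint S) (hk : 0 ≤ k) (h : PropagateCond Γ N U C L σ π) :
      Propagate ⟨Γ, N, U, k, .top⟩ ⟨Γ ++ [.deduced C L σ π], N, U, k, .top⟩

inductive Decide : State S → State S → Prop
  | mk (Γ : Trail S) (N U : Set (Clause S)) (k : ℤ) (L : Literal S) (π : Constraint S) (i : ℕ)
      (hk : 0 ≤ k) (hi : (i : ℤ) = k + 1) (h : DecideCond Γ N U L π) :
      Decide ⟨Γ, N, U, k, .top⟩ ⟨Γ ++ [.decision L π i], N, U, k + 1, .top⟩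

inductive Conflict : State S → State S → Prop
  | mk (Γ : Trail S) (N U : Set (Clause S)) (k : ℤ) (C : Clause S) (σ : Subst S)
      (π : Constraint S) (hk : 0 ≤ k) (hC : C ∈ N ∪ U) (hne : C ≠ 0)
      (hf : FalseClause Γ (clauseSubst σ C) π) (hg : (gndClause (clauseSubst σ C) π).Nonempty) :
      Conflict ⟨Γ, N, U, k, .top⟩ ⟨Γ, N, U, k, .conflict C σ π⟩

inductive Success : State S → State S → Prop
  | mk (Γ : Trail S) (N U : Set (Clause S)) (k : ℤ) (hk : 0 ≤ k)
      (h : ∀ C ∈ N, Sat (inducedInterp Γ) C) :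
      Success ⟨Γ, N, U, k, .top⟩ ⟨Γ, N, U, -1, .top⟩

inductive Failure : State S → State S → Prop
  | mk (Γ : Trail S) (N U : Set (Clause S)) (k : ℤ) (h : (0 : Clause S) ∈ N ∪ U) :
      Failure ⟨Γ, N, U, k, .top⟩ ⟨Γ, N, U, 0, .bot⟩

/-- The last element of the trail touches the conflict set `(C; σ; π)`: with a variant `e` of that
element that shares no variables with `Cσ` and `π`, some literal of `Cσ` unifies with the
complement of the literal of `e` such that the instance is not empty. -/
def Touches (e₀ : Entry S) (C : Clause S) (σ : Subst S) (π : Constraint S) : Prop :=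
  ∃ e : Entry S, e.IsVariant e₀ ∧
    Disjoint (clauseVars (clauseSubst σ C) ∪ π.lvars) e.instVars ∧
    ∃ L ∈ C, ∃ η : Subst S, IsMGU η {e.lit, (litSubst σ L).neg} ∧
      (gndClause (clauseSubst η (clauseSubst σ C))
        ((π.subst η).and (e.constr.subst η))).Nonempty

inductive Skip : State S → State S → Prop
  | mk (Γ : Trail S) (N U : Set (Clause S)) (k : ℤ) (C' : Clause S) (L' : Literal S)
      (σ' : Subst S) (π' : Constraint S) (C : Clause S) (σ : Subst S) (π : Constraint S)
      (h : ¬ Touches (.deduced C' L' σ' π') C σ π) :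
      Skip ⟨Γ ++ [.deduced C' L' σ' π'], N, U, k, .conflict C σ π⟩
        ⟨Γ, N, U, k, .conflict C σ π⟩

/-- Resolution of the conflict clause `C ∨ L` with the reason `C' ∨ L'` of the last element `e₀`
of the trail. `(L'·σ'; π')` with reason `C' ∨ L'` is a variant of `e₀`, variable disjoint from the
conflict; `σs` plays the role of `σ*`, that is `η₀σ* = σσ'η` on the variables of the two clauses;
`πs` is the (normalized) constraint `πη ∧ π'η`. -/
inductive Resolve : State S → State S → Prop
  | mk (Γ : Trail S) (N U : Set (Clause S)) (k : ℤ) (e₀ : Entry S)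
      (C' : Clause S) (L' : Literal S) (σ' : Subst S) (π' : Constraint S)
      (C : Clause S) (L : Literal S) (σ : Subst S) (π : Constraint S)
      (η η₀ σs : Subst S) (πs : Constraint S)
      (hvar : Entry.IsVariant (.deduced C' L' σ' π') e₀)
      (hdisj : Disjoint (clauseVars (L ::ₘ C)) (clauseVars (L' ::ₘ C')))
      (hdisjI : Disjoint (clauseVars (clauseSubst σ (L ::ₘ C)) ∪ π.lvars)
        (Entry.instVars (.deduced C' L' σ' π')))
      (hass : ¬ Assertive (Γ ++ [e₀]) (clauseSubst σ (L ::ₘ C)) π ∨ k = 0)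
      (hη : IsMGU η {litSubst σ' L', (litSubst σ L).neg})
      (hη₀ : IsMGU η₀ {L', L.neg})
      (hσ : ∀ x ∈ clauseVars (L ::ₘ C), (η₀ x).subst σs = (σ x).subst η)
      (hσ' : ∀ x ∈ clauseVars (L' ::ₘ C'), (η₀ x).subst σs = (σ' x).subst η)
      (hne : (gndClause (clauseSubst η (clauseSubst σ (L ::ₘ C)))
        ((π.subst η).and (π'.subst η))).Nonempty)
      (hπ : πs.Equivalent ((π.subst η).and (π'.subst η))) :
      Resolve ⟨Γ ++ [e₀], N, U, k, .conflict (L ::ₘ C) σ π⟩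
        ⟨Γ ++ [e₀], N, U, k, .conflict (clauseSubst η₀ (C + C')) σs πs⟩

/-- Factorization of the conflict clause `C ∨ L₁ ∨ L₂`, guided by the last element `e₀` of the
trail; `e` is a variant of `e₀`, variable disjoint from the conflict; `σs` plays the role of `σ*`,
that is `η₀σ* = ση` on the variables of the clause; `πs` is the (normalized) constraint `πη`. -/
inductive Factorize : State S → State S → Prop
  | mk (Γ : Trail S) (N U : Set (Clause S)) (k : ℤ) (e₀ e : Entry S)
      (C : Clause S) (L₁ L₂ : Literal S) (σ : Subst S) (π : Constraint S)
      (η η₀ σs : Subst S) (πs : Constraint S)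
      (hvar : e.IsVariant e₀)
      (hdisjI : Disjoint (clauseVars (clauseSubst σ (L₁ ::ₘ L₂ ::ₘ C)) ∪ π.lvars) e.instVars)
      (hη : IsMGU η {litSubst σ L₁, litSubst σ L₂, e.lit.neg})
      (hη₀ : IsMGU η₀ {L₁, L₂})
      (hσ : ∀ x ∈ clauseVars (L₁ ::ₘ L₂ ::ₘ C), (η₀ x).subst σs = (σ x).subst η)
      (hne : (gndClause (clauseSubst η (clauseSubst σ (L₁ ::ₘ C)))
        ((π.subst η).and (e.constr.subst η))).Nonempty)
      (hπ : πs.Equivalent (π.subst η)) :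
      Factorize ⟨Γ ++ [e₀], N, U, k, .conflict (L₁ ::ₘ L₂ ::ₘ C) σ π⟩
        ⟨Γ ++ [e₀], N, U, k, .conflict (clauseSubst η₀ (L₁ ::ₘ C)) σs πs⟩

/-- The three alternative conditions of Backjump, for the trail `Γ₁, Γ₂`. -/
def BackjumpCond (Γ₁ Γ₂ : Trail S) (N U : Set (Clause S)) (k : ℤ) (C : Clause S) (σ : Subst S)
    (π : Constraint S) : Prop :=
  (k = 0 ∧ C = 0) ∨
  (0 < k ∧ Assertive (Γ₁ ++ Γ₂) (clauseSubst σ C) π ∧ ¬ HasFalseInstance Γ₁ C) ∨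
  (0 < k ∧
    (∃ (Γ₃ : Trail S) (L : Literal S) (π' : Constraint S),
      Γ₂ = Γ₃ ++ [.decision L π' (trailLevel (Γ₁ ++ Γ₂))]) ∧
    ¬ Assertive (Γ₁ ++ Γ₂) (clauseSubst σ C) π ∧
    (¬ ∃ s : State S, Factorize ⟨Γ₁ ++ Γ₂, N, U, k, .conflict C σ π⟩ s) ∧
    ¬ HasFalseInstance Γ₁ C)

inductive Backjump : State S → State S → Prop
  | mk (Γ₁ Γ₂ : Trail S) (N U : Set (Clause S)) (k k' : ℤ) (C : Clause S) (σ : Subst S)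
      (π : Constraint S) (h0 : 0 ≤ k') (hk : k' ≤ k) (hl : k' = trailLevel Γ₁)
      (h : BackjumpCond Γ₁ Γ₂ N U k C σ π) :
      Backjump ⟨Γ₁ ++ Γ₂, N, U, k, .conflict C σ π⟩ ⟨Γ₁, N, U ∪ {C}, k', .top⟩

end Rules

/-- Names of the rules. -/
inductive Rule where
  | propagate | decide | conflict | success | failure | skip | resolve | factorize | backjump

section Runs

variable {S : Signature.{u, v}}

/-- `Step r s s'`: the rule `r` leads from the state `s` to the state `s'`. -/
def Step : Rule → State S → State S → Prop
  | .propagate => Propagate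
  | .decide => Decide
  | .conflict => Conflict
  | .success => Success
  | .failure => Failure
  | .skip => Skip
  | .resolve => Resolve
  | .factorize => Factorize
  | .backjump => Backjump

def Applicable (r : Rule) (s : State S) : Prop := ∃ s', Step r s s'

/-- Well-formed trails. -/
structure WellFormed (Γ : Trail S) (N U : Set (Clause S)) (k : ℤ) : Prop where
  count : 0 ≤ k → ((decisionLevels Γ).length : ℤ) = k
  unique : ∀ i : ℕ, 1 ≤ i → (i : ℤ) ≤ k → (decisionLevels Γ).count i = 1
  order : (decisionLevels Γ).Pairwise (· < ·)
  decision : ∀ (Γ₁ Γ₂ : Trail S) (L : Literal S) (π : Constraint S) (i : ℕ),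
    Γ = Γ₁ ++ .decision L π i :: Γ₂ → DecideCond Γ₁ N U L π
  deduced : ∀ (Γ₁ Γ₂ : Trail S) (C : Clause S) (L : Literal S) (σ : Subst S)
    (π : Constraint S), Γ = Γ₁ ++ .deduced C L σ π :: Γ₂ → PropagateCond Γ₁ N U C L σ π

/-- Sound states. -/
structure Sound (s : State S) : Prop where
  consistent : StronglyConsistent s.trail
  wellFormed : WellFormed s.trail s.N s.U s.k
  learned : ∀ C ∈ s.U, Entails s.N C
  bot : s.ind = .bot → (0 : Clause S) ∈ s.N ∪ s.U
  success : s.k = -1 → ∀ C ∈ s.N, Sat (inducedInterp s.trail) C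
  conflict : ∀ (C : Clause S) (σ : Subst S) (π : Constraint S), s.ind = .conflict C σ π →
    FalseClause s.trail (clauseSubst σ C) π ∧ Entails s.N C ∧
      (gndClause (clauseSubst σ C) π).Nonempty

/-- Regular states. -/
structure Regular (s : State S) : Prop where
  sound : Sound s
  noFalse : ∀ (Γ' : Trail S) (e : Entry S), s.trail = Γ' ++ [e] →
    ∀ C ∈ s.N ∪ s.U, ¬ HasFalseInstance Γ' C
  exhausted : ∀ (Γ₁ Γ₂ : Trail S) (L : Literal S) (π : Constraint S) (i : ℕ),
    s.trail = Γ₁ ++ .decision L π i :: Γ₂ →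
    ∀ (C : Clause S) (K : Literal S) (σ : Subst S) (π' : Constraint S),
      ¬ PropagateCond Γ₁ s.N s.U C K σ π'

/-- The rules that have to be exhausted before a rule of conflict search, in the order: terminal
rules, Conflict, Propagate, Decide. -/
def before : Rule → List Rule
  | .conflict => [.failure, .success]
  | .propagate => [.failure, .success, .conflict]
  | .decide => [.failure, .success, .conflict, .propagate]
  | _ => []

/-- The same for the order: Failure, Conflict, Propagate, Decide, Success. -/
def beforeAlt : Rule → List Rule
  | .conflict => [.failure]
  | .propagate => [.failure, .conflict]
  | .decide => [.failure, .conflict, .propagate]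
  | .success => [.failure, .conflict, .propagate, .decide]
  | _ => []

/-- A derivation with (finite or infinite) length `len`: step `i` leads from `st i` to
`st (i + 1)` by the rule `rule i`, for `i < len`. -/
def IsDerivation (st : ℕ → State S) (rule : ℕ → Rule) (len : ℕ∞) : Prop :=
  ∀ i : ℕ, (i : ℕ∞) < len → Step (rule i) (st i) (st (i + 1))

/-- Runs are derivations from a sound state; regular runs follow the regular strategy. -/
structure IsRegularRun (st : ℕ → State S) (rule : ℕ → Rule) (len : ℕ∞) : Prop where
  steps : IsDerivation st rule len
  start : Regular (st 0)
  search :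
    (∀ i : ℕ, (i : ℕ∞) < len → ∀ r ∈ before (rule i), ¬ Applicable r (st i)) ∨
    (∀ i : ℕ, (i : ℕ∞) < len → ∀ r ∈ beforeAlt (rule i), ¬ Applicable r (st i))
  asap : ∀ i : ℕ, (i : ℕ∞) < len →
    rule i = .skip ∨ rule i = .resolve ∨ rule i = .factorize → ¬ Applicable .backjump (st i)
  backtrack : ∀ i : ℕ, (i : ℕ∞) < len → rule i = .backjump → Regular (st (i + 1))

end Runs

/-! ### The ordering induced by a trail, and redundancy -/

/-- The multiset extension of a relation. -/
def MulExt {α : Type*} (r : α → α → Prop) (M M' : Multiset α) : Prop :=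
  ∃ X Y Z : Multiset α, M = X + Y ∧ M' = X + Z ∧ Z ≠ 0 ∧ ∀ y ∈ Y, ∃ z ∈ Z, r y z

/-- The extension of an atom ordering to literals: compare the atoms first; a positive literal is
smaller than its complement. -/
def litLT {A : Type*} (r : A → A → Prop) (L L' : Lit A) : Prop :=
  r L.atom L'.atom ∨ (L.atom = L'.atom ∧ L.pos = true ∧ L'.pos = false)

section Ordering

variable {S : Signature.{u, v}}

open Classical in
/-- The abstraction of a ground atom: the element of the trail that defines it, given by its
position; `⊤` if the atom is undefined. -/
noncomputable def absAtom (Γ : Trail S) (A : GAtom S) : WithTop ℕ :=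
  if h : ∃ i : ℕ, ∃ e : Entry S, Γ[i]? = some e ∧ e.Defines A then ((Nat.find h : ℕ) : WithTop ℕ)
  else ⊤

noncomputable def absLit (Γ : Trail S) (K : GLiteral S) : Lit (WithTop ℕ) :=
  ⟨K.pos, absAtom Γ K.atom⟩

noncomputable def absClause (Γ : Trail S) (G : GClause S) : Multiset (Lit (WithTop ℕ)) :=
  G.map (absLit Γ)

/-- The atom ordering induced by `Γ` and the base ordering `lt`. -/
def inducedAtomLT (lt : GAtom S → GAtom S → Prop) (Γ : Trail S) (A B : GAtom S) : Prop :=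
  absAtom Γ A < absAtom Γ B ∨ (absAtom Γ A = absAtom Γ B ∧ lt A B)

/-- The ordering on ground clauses induced by `Γ` and the base ordering `lt`. -/
def inducedLT (lt : GAtom S → GAtom S → Prop) (Γ : Trail S) (G H : GClause S) : Prop :=
  MulExt (litLT (· < ·)) (absClause Γ G) (absClause Γ H) ∨
  (absClause Γ G = absClause Γ H ∧ MulExt (litLT (inducedAtomLT lt Γ)) G H)

/-- Redundancy of a ground clause with respect to a ground clause set. -/
def RedundantG (r : GClause S → GClause S → Prop) (M : Set (GClause S)) (G : GClause S) : Prop :=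
  G ∈ M ∨ ∃ T ⊆ {H | H ∈ M ∧ r H G}, GEntails T G

/-- Redundancy of a clause with respect to a clause set. -/
def Redundant (r : GClause S → GClause S → Prop) (M : Set (Clause S)) (C : Clause S) : Prop :=
  ∀ G ∈ gnd C, RedundantG r (gndSet M) G

end Ordering

end NRCL

namespace NRCL

variable {S : Signature.{u, v}}

/-! ### Substitutions and grounding -/

/-! Let `Γ` be the trail at Conflict. Conflict search preserves regularity, because the strategy
exhausts Conflict before Propagate and also Propagate before Decide; so the state at Conflict is
regular (`IsRegularRun.regular`). Conflict resolution only shortens the trail and keeps a nonempty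
constrained clause that is false under what remains (`IsConflictState.step`), so a learned clause
has a false ground instance `G`.

If `G` were redundant, then, since the interpretation induced by `Γ` falsifies `G`, some clause `H`
of `gndSet (N ∪ U)` would be false under `Γ` and not above `G` (`RedundantG.exists_false`). By
regularity `H` is not false without the last element `e` of `Γ`, so it contains a literal falsified
by `e`; such a literal is maximal in the abstract ordering, so `G` contains one too
(`Regular.exists_last_of_redundantG`). This is contradicted case by case. If Skip has removed `e`,
then `G` is false without `e`. If `G` is assertive, then all literals of `H` but one are false
before the last decision, and Propagate was applicable there. If `e` is a decision and the clause is
neither assertive nor factorizable, then `G` has at least two literals falsified by `e`; they cannot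
be equal, as Factorize would apply, nor different, as the decision would have been blocked by the
original conflict clause. At level 0 the learned clause is empty: nothing lies below it, and Failure
was not applicable. -/

/-- A ground substitution, seen as a substitution. -/
def constSubst (δ : ℕ → S.Const) : Subst S := fun x => .const (δ x)

/-- Composition of a substitution with a ground substitution. -/
def groundComp (σ : Subst S) (δ : ℕ → S.Const) : ℕ → S.Const := fun x => (σ x).ground δ

theorem Term.ground_subst (σ : Subst S) (δ : ℕ → S.Const) (t : Term S) :
    (t.subst σ).ground δ = t.ground (groundComp σ δ) := by
  cases t <;> rfl

theorem Term.subst_constSubst (δ : ℕ → S.Const) (t : Term S) :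
    t.subst (constSubst δ) = .const (t.ground δ) := by
  cases t <;> rfl

theorem litGround_litSubst (σ : Subst S) (δ : ℕ → S.Const) (L : Literal S) :
    litGround δ (litSubst σ L) = litGround (groundComp σ δ) L := by
  simp only [litGround, litSubst, litMap, Term.ground_subst]

theorem clauseGround_clauseSubst (σ : Subst S) (δ : ℕ → S.Const) (C : Clause S) :
    clauseGround δ (clauseSubst σ C) = clauseGround (groundComp σ δ) C := by
  simp only [clauseGround, clauseSubst, Multiset.map_map, Function.comp_def, litGround_litSubst]

theorem groundComp_constSubst (δ ε : ℕ → S.Const) : groundComp (constSubst δ) ε = δ := rfl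

theorem groundComp_permSubst (ρ : Equiv.Perm ℕ) (δ : ℕ → S.Const) :
    groundComp (permSubst S ρ) δ = fun x => δ (ρ x) := rfl

theorem litGround_neg (δ : ℕ → S.Const) (L : Literal S) :
    litGround δ L.neg = (litGround δ L).neg := rfl

theorem Lit.neg_neg {A : Type*} (L : Lit A) : L.neg.neg = L := by
  cases L; simp [Lit.neg]

theorem litMap_congr {α β : Type v} {f g : α → β} {L : Lit (Atom S α)}
    (h : ∀ i, f (L.atom.args i) = g (L.atom.args i)) : litMap f L = litMap g L := by
  simp only [litMap, h]

theorem litMap_eq_iff {α β γ : Type v} {f : α → β} {g : α → γ} {L K : Lit (Atom S α)}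
    (hf : litMap f L = litMap f K)
    (h : ∀ s t : α, f s = f t → g s = g t) : litMap g L = litMap g K := by
  obtain ⟨b, p, a⟩ := L
  obtain ⟨b', p', a'⟩ := K
  simp only [litMap, Lit.mk.injEq, Atom.mk.injEq] at hf ⊢
  obtain ⟨rfl, rfl, h2⟩ := hf
  refine ⟨rfl, rfl, heq_of_eq (funext fun i => h _ _ (congrFun (eq_of_heq h2) i))⟩

/-- The index `i₀` makes the family nonempty, which is needed to get equal polarities and
predicates; the arguments are then compared one by one, using the whole family. -/
theorem litMap_eq_of_forall {ι : Type*} {α β γ : Type v} {f : ι → α → β} {g : α → γ}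
    {L K : Lit (Atom S α)} (i₀ : ι) (hf : ∀ i, litMap (f i) L = litMap (f i) K)
    (h : ∀ s t : α, (∀ i, f i s = f i t) → g s = g t) : litMap g L = litMap g K := by
  obtain ⟨b, p, a⟩ := L
  obtain ⟨b', p', a'⟩ := K
  simp only [litMap, Lit.mk.injEq, Atom.mk.injEq] at hf ⊢
  obtain ⟨rfl, rfl, -⟩ := hf i₀
  refine ⟨rfl, rfl, heq_of_eq (funext fun j => h _ _ fun i => ?_)⟩
  exact congrFun (eq_of_heq (hf i).2.2) j

theorem litGround_congr {δ ε : ℕ → S.Const} {L : Literal S} (h : ∀ x ∈ litVars L, δ x = ε x) :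
    litGround δ L = litGround ε L := by
  refine litMap_congr fun i => ?_
  cases hi : L.atom.args i with
  | var x => exact h x ⟨i, hi⟩
  | const c => rfl

theorem clauseGround_congr {δ ε : ℕ → S.Const} {C : Clause S}
    (h : ∀ x ∈ clauseVars C, δ x = ε x) : clauseGround δ C = clauseGround ε C :=
  Multiset.map_congr rfl fun L hL => litGround_congr fun x hx => h x ⟨L, hL, hx⟩

theorem Constraint.solves_subst (σ : Subst S) (δ : ℕ → S.Const) (π : Constraint S) :
    (π.subst σ).Solves δ ↔ π.Solves (groundComp σ δ) := by
  cases π with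
  | bot => rfl
  | conj l => simp [Constraint.subst, Constraint.Solves, Diseq.Solves, Diseq.subst,
      Term.ground_subst]

theorem Constraint.solves_and (δ : ℕ → S.Const) (π π' : Constraint S) :
    (π.and π').Solves δ ↔ π.Solves δ ∧ π'.Solves δ := by
  cases π <;> cases π' <;> simp [Constraint.and, Constraint.Solves, or_imp, forall_and]

theorem Constraint.solves_top (δ : ℕ → S.Const) : (Constraint.top : Constraint S).Solves δ := by
  simp [Constraint.top, Constraint.Solves]

theorem Constraint.solves_congr {δ ε : ℕ → S.Const} {π : Constraint S}
    (h : ∀ x ∈ π.lvars, δ x = ε x) (hδ : π.Solves δ) : π.Solves ε := by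
  cases π with
  | bot => exact hδ
  | conj l =>
    intro d hd ⟨τ, hτ⟩
    refine hδ d hd ⟨τ, fun i => ?_⟩
    rw [← hτ i]
    cases hi : d.lhs i with
    | var x => exact h x ⟨d, hd, i, hi⟩
    | const c => rfl

theorem gndClause_subset_gnd (C : Clause S) (σ : Subst S) (π : Constraint S) :
    gndClause (clauseSubst σ C) π ⊆ gnd C := by
  rintro G ⟨δ, -, rfl⟩
  exact ⟨_, clauseGround_clauseSubst σ δ C⟩

/-! ### Unification -/

/-- A set of function-free literals with a unifier has a most general one. -/
theorem exists_isMGU {E : Set (Literal S)} {θ : Subst S}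
    (hθ : ∀ K ∈ E, ∀ L ∈ E, litSubst θ K = litSubst θ L) : ∃ η : Subst S, IsMGU η E := by
  classical
  let U := {θ : Subst S // ∀ K ∈ E, ∀ L ∈ E, litSubst θ K = litSubst θ L}
  -- Terms are identified when every unifier of `E` identifies them. Without function symbols, a
  -- most general unifier just picks one representative per class, namely a constant if the class
  -- contains one.
  let R : Setoid (Term S) :=
    { r := fun s t => ∀ θ : U, s.subst θ.1 = t.subst θ.1
      iseqv := ⟨fun _ _ => rfl, fun h θ => (h θ).symm, fun h h' θ => (h θ).trans (h' θ)⟩ }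
  let rep : Quotient R → Term S := fun q =>
    if h : ∃ c : S.Const, (⟦.const c⟧ : Quotient R) = q then .const h.choose else q.out
  have hrep : ∀ q, (⟦rep q⟧ : Quotient R) = q := by
    intro q
    by_cases h : ∃ c : S.Const, (⟦.const c⟧ : Quotient R) = q
    · simp only [rep, dif_pos h]; exact h.choose_spec
    · simp only [rep, dif_neg h]; exact q.out_eq
  have hconst : ∀ c : S.Const, rep ⟦.const c⟧ = .const c := by
    intro c
    have h : ∃ d : S.Const, (⟦.const d⟧ : Quotient R) = ⟦.const c⟧ := ⟨c, rfl⟩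
    simp only [rep, dif_pos h]
    -- A class contains at most one constant: the given unifier `θ` fixes constants, so it
    -- identifies no two of them.
    exact Quotient.exact h.choose_spec ⟨θ, hθ⟩
  let η : Subst S := fun x => rep ⟦.var x⟧
  have hη : ∀ t : Term S, t.subst η = rep ⟦t⟧ := by
    intro t
    cases t with
    | var x => rfl
    | const c => exact (hconst c).symm
  refine ⟨η, fun K hK L hL => ?_, fun θ' hθ' => ⟨θ', fun x => ?_⟩⟩
  · refine litMap_eq_of_forall (ι := U) (f := fun θ => Term.subst θ.1) ⟨θ, hθ⟩
      (fun θ => θ.2 K hK L hL) fun s t hst => ?_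
    rw [hη, hη]
    exact congrArg rep (Quotient.sound hst)
  · exact (Quotient.exact (hrep ⟦.var x⟧) ⟨θ', hθ'⟩).symm

theorem litSubst_constSubst_eq {θ : ℕ → S.Const} {K L : Literal S}
    (h : litGround θ K = litGround θ L) :
    litSubst (constSubst θ) K = litSubst (constSubst θ) L := by
  refine litMap_eq_iff h fun s t hst => ?_
  rw [Term.subst_constSubst, Term.subst_constSubst, hst]

/-- A ground unifier factors through a most general unifier. -/
theorem IsMGU.exists_ground {η : Subst S} {E : Set (Literal S)} (hη : IsMGU η E)
    {θ : ℕ → S.Const} (hθ : ∀ K ∈ E, ∀ L ∈ E, litGround θ K = litGround θ L) :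
    ∃ τ : ℕ → S.Const, groundComp η τ = θ := by
  obtain ⟨τ, hτ⟩ := hη.2 (constSubst θ) fun K hK L hL => litSubst_constSubst_eq (hθ K hK L hL)
  -- Each `(η x).subst τ` is already a constant, so any ground substitution could be used to ground
  -- `τ`.
  refine ⟨fun x => (τ x).ground θ, funext fun x => ?_⟩
  have := congrArg (Term.ground θ) (hτ x)
  rw [Term.ground_subst] at this
  exact this.symm

theorem exists_isMGU_of_ground {E : Set (Literal S)} {θ : ℕ → S.Const}
    (hθ : ∀ K ∈ E, ∀ L ∈ E, litGround θ K = litGround θ L) :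
    ∃ η : Subst S, IsMGU η E ∧ ∃ τ : ℕ → S.Const, groundComp η τ = θ := by
  obtain ⟨η, hη⟩ := exists_isMGU fun K hK L hL => litSubst_constSubst_eq (hθ K hK L hL)
  exact ⟨η, hη, hη.exists_ground hθ⟩

theorem litSubst_litSubst (σ τ : Subst S) (L : Literal S) :
    litSubst τ (litSubst σ L) = litSubst (fun x => (σ x).subst τ) L := by
  refine congrArg (Lit.mk L.pos) (congrArg (Atom.mk L.atom.pred) (funext fun i => ?_))
  change ((L.atom.args i).subst σ).subst τ = _
  cases L.atom.args i <;> rfl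

/-! ### Variants -/

theorem finite_litVars (L : Literal S) : (litVars L).Finite := by
  have : litVars L = ⋃ i, {x | L.atom.args i = Term.var x} := by ext x; simp [litVars]
  rw [this]
  refine Set.finite_iUnion fun i => Set.Subsingleton.finite fun x hx y hy => ?_
  exact Term.var.inj (hx.symm.trans hy)

theorem finite_clauseVars (C : Clause S) : (clauseVars C).Finite := by
  classical
  have : clauseVars C = ⋃ L ∈ {L | L ∈ C}, litVars L := by ext x; simp [clauseVars]
  rw [this]
  refine Set.Finite.biUnion ?_ fun L _ => finite_litVars L
  exact C.toFinset.finite_toSet.subset fun L hL => by simpa using hL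

theorem Constraint.finite_lvars (π : Constraint S) : π.lvars.Finite := by
  cases π with
  | bot => exact Set.finite_empty
  | conj l =>
    have : (Constraint.conj l).lvars = ⋃ d ∈ {d | d ∈ l}, ⋃ i, {x | d.lhs i = Term.var x} := by
      ext x; simp [Constraint.lvars]
    rw [this]
    refine Set.Finite.biUnion l.finite_toSet fun d _ =>
      Set.finite_iUnion fun i => Set.Subsingleton.finite fun x hx y hy => ?_
    exact Term.var.inj (hx.symm.trans hy)

theorem Entry.finite_instVars (e : Entry S) : e.instVars.Finite := by
  cases e with
  | decision L π i => exact (finite_litVars L).union π.finite_lvars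
  | deduced C L σ π => exact (finite_clauseVars _).union π.finite_lvars

theorem exists_perm_disjoint {A B : Set ℕ} (hA : A.Finite) (hB : B.Finite) :
    ∃ ρ : Equiv.Perm ℕ, Disjoint B (ρ '' A) := by
  obtain ⟨n, hn⟩ := (hA.union hB).bddAbove
  -- The involution that exchanges the blocks `0, …, n` and `n + 1, …, 2n + 1`; both sets of
  -- variables lie in the first block.
  let f : ℕ → ℕ := fun x => if x ≤ n then x + (n + 1) else if x ≤ 2 * n + 1 then x - (n + 1) else x
  have hf : Function.Involutive f := by
    intro x
    simp only [f]
    split_ifs <;> omega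
  refine ⟨hf.toPerm, Set.disjoint_left.2 ?_⟩
  rintro _ hx ⟨y, hy, rfl⟩
  have h1 : y ≤ n := hn (Or.inl hy)
  have h2 : f y ≤ n := hn (Or.inr hx)
  simp only [f, if_pos h1] at h2
  omega

theorem litVars_permSubst (ρ : Equiv.Perm ℕ) (L : Literal S) :
    litVars (litSubst (permSubst S ρ) L) ⊆ ρ '' litVars L := by
  rintro x ⟨i, hi⟩
  change (L.atom.args i).subst (permSubst S ρ) = _ at hi
  cases h : L.atom.args i with
  | var y => rw [h] at hi; exact ⟨y, ⟨i, h⟩, Term.var.inj hi⟩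
  | const c => rw [h] at hi; cases hi

theorem Constraint.lvars_permSubst (ρ : Equiv.Perm ℕ) (π : Constraint S) :
    (π.subst (permSubst S ρ)).lvars ⊆ ρ '' π.lvars := by
  cases π with
  | bot => rintro x ⟨⟩
  | conj l =>
    rintro x ⟨d', hd', i, hi⟩
    obtain ⟨d, hd, rfl⟩ := List.mem_map.1 hd'
    change (d.lhs i).subst (permSubst S ρ) = _ at hi
    cases h : d.lhs i with
    | var y => rw [h] at hi; exact ⟨y, ⟨d, hd, i, h⟩, Term.var.inj hi⟩
    | const c => rw [h] at hi; cases hi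

/-- Instances commute with renaming. -/
theorem litSubst_rename (ρ : Equiv.Perm ℕ) (σ : Subst S) (L : Literal S) :
    litSubst (fun x => (σ (ρ.symm x)).subst (permSubst S ρ)) (litSubst (permSubst S ρ) L) =
      litSubst (permSubst S ρ) (litSubst σ L) := by
  rw [litSubst_litSubst, litSubst_litSubst]
  simp [permSubst, Term.subst]

theorem clauseSubst_rename (ρ : Equiv.Perm ℕ) (σ : Subst S) (C : Clause S) :
    clauseSubst (fun x => (σ (ρ.symm x)).subst (permSubst S ρ)) (clauseSubst (permSubst S ρ) C) =
      clauseSubst (permSubst S ρ) (clauseSubst σ C) := by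
  simp only [clauseSubst, Multiset.map_map, Function.comp_def, litSubst_rename]

theorem clauseVars_permSubst (ρ : Equiv.Perm ℕ) (C : Clause S) :
    clauseVars (clauseSubst (permSubst S ρ) C) ⊆ ρ '' clauseVars C := by
  rintro x ⟨L', hL', hx⟩
  obtain ⟨L, hL, rfl⟩ := Multiset.mem_map.1 hL'
  obtain ⟨y, hy, rfl⟩ := litVars_permSubst ρ L hx
  exact ⟨y, ⟨L, hL, hy⟩, rfl⟩

theorem Entry.lit_rename (ρ : Equiv.Perm ℕ) (e : Entry S) :
    (e.rename ρ).lit = litSubst (permSubst S ρ) e.lit := by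
  cases e with
  | decision L π i => rfl
  | deduced C L σ π => exact litSubst_rename ρ σ L

theorem Entry.constr_rename (ρ : Equiv.Perm ℕ) (e : Entry S) :
    (e.rename ρ).constr = e.constr.subst (permSubst S ρ) := by
  cases e <;> rfl

theorem Entry.instVars_rename (ρ : Equiv.Perm ℕ) (e : Entry S) :
    (e.rename ρ).instVars ⊆ ρ '' e.instVars := by
  cases e with
  | decision L π i =>
    rw [Entry.instVars, Set.image_union]
    exact Set.union_subset_union (litVars_permSubst ρ L) (π.lvars_permSubst ρ)
  | deduced C L σ π =>
    rw [Entry.instVars, Set.image_union]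
    refine Set.union_subset_union ?_ (π.lvars_permSubst ρ)
    have h2 := clauseVars_permSubst ρ (clauseSubst σ (L ::ₘ C))
    rw [← clauseSubst_rename] at h2
    simpa [clauseSubst, Entry.rename] using h2

theorem Entry.litVars_subset_instVars (e : Entry S) : litVars e.lit ⊆ e.instVars := by
  cases e with
  | decision L π i => exact Set.subset_union_left
  | deduced C L σ π =>
    exact fun x hx => Or.inl ⟨_, Multiset.mem_map_of_mem _ (Multiset.mem_cons_self L C), hx⟩

theorem Entry.lvars_subset_instVars (e : Entry S) : e.constr.lvars ⊆ e.instVars := by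
  cases e <;> exact Set.subset_union_right

/-- A variant of a trail element, away from a finite set of variables, together with a joint
extension of two ground substitutions. -/
theorem Entry.exists_variant (e₀ : Entry S) {V : Set ℕ} (hV : V.Finite) (δ δ' : ℕ → S.Const)
    (hδ' : e₀.constr.Solves δ') :
    ∃ e : Entry S, e.IsVariant e₀ ∧ Disjoint V e.instVars ∧ ∃ θ : ℕ → S.Const,
      (∀ x ∈ V, θ x = δ x) ∧ e.constr.Solves θ ∧ litGround θ e.lit = litGround δ' e₀.lit := by
  classical
  obtain ⟨ρ, hρ⟩ := exists_perm_disjoint e₀.finite_instVars hV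
  have hd : Disjoint V (e₀.rename ρ).instVars := hρ.mono_right (e₀.instVars_rename ρ)
  -- The glued substitution follows `δ` on `V` and undoes the renaming elsewhere; renamed variables
  -- avoid `V`, so on the variant it behaves as `δ'` does on `e₀`.
  have key : ∀ x ∈ e₀.instVars, (if ρ x ∈ V then δ (ρ x) else δ' (ρ.symm (ρ x))) = δ' x := by
    intro x hx
    rw [if_neg (fun h => Set.disjoint_left.1 hρ h ⟨x, hx, rfl⟩), ρ.symm_apply_apply]
  refine ⟨e₀.rename ρ, ⟨ρ, rfl⟩, hd, fun x => if x ∈ V then δ x else δ' (ρ.symm x),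
    fun x hx => if_pos hx, ?_, ?_⟩
  · rw [Entry.constr_rename, Constraint.solves_subst, groundComp_permSubst]
    exact Constraint.solves_congr (fun x hx => (key x (e₀.lvars_subset_instVars hx)).symm) hδ'
  · rw [Entry.lit_rename, litGround_litSubst, groundComp_permSubst]
    exact litGround_congr fun x hx => key x (e₀.litVars_subset_instVars hx)

/-! ### Falsity and abstraction with respect to a trail -/

theorem FalseLit.append {Γ : Trail S} {K : GLiteral S} (h : FalseLit Γ K) (Δ : Trail S) :
    FalseLit (Γ ++ Δ) K := by
  obtain ⟨e, he, hK⟩ := h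
  exact ⟨e, List.mem_append_left _ he, hK⟩

theorem FalseG.append {Γ : Trail S} {G : GClause S} (h : FalseG Γ G) (Δ : Trail S) :
    FalseG (Γ ++ Δ) G := fun K hK => (h K hK).append Δ

theorem falseLit_concat {Γ : Trail S} {e : Entry S} {K : GLiteral S} :
    FalseLit (Γ ++ [e]) K ↔ FalseLit Γ K ∨ K.neg ∈ e.covered := by
  simp [FalseLit, or_and_right, exists_or]

theorem Entry.pos_of_mem_covered {e : Entry S} {K : GLiteral S} (h : K ∈ e.covered) :
    K.pos = e.lit.pos := by
  obtain ⟨δ, -, rfl⟩ := h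
  rfl

theorem Entry.defines_of_neg_mem {e : Entry S} {K : GLiteral S} (h : K.neg ∈ e.covered) :
    e.Defines K.atom := ⟨_, h, rfl⟩

theorem Entry.mem_or_neg_mem_of_defines {e : Entry S} {K : GLiteral S} (h : e.Defines K.atom) :
    K ∈ e.covered ∨ K.neg ∈ e.covered := by
  obtain ⟨⟨b, A⟩, hK', hA⟩ := h
  obtain ⟨b', A'⟩ := K
  obtain rfl : A = A' := hA
  cases b <;> cases b' <;> simp [Lit.neg, hK']

theorem StronglyConsistent.index_eq {Γ : Trail S} (hΓ : StronglyConsistent Γ) {i j : ℕ}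
    {e e' : Entry S} {A : GAtom S} (hi : Γ[i]? = some e) (hj : Γ[j]? = some e')
    (he : e.Defines A) (he' : e'.Defines A) : i = j := by
  obtain ⟨hi1, rfl⟩ := List.getElem?_eq_some_iff.1 hi
  obtain ⟨hj1, rfl⟩ := List.getElem?_eq_some_iff.1 hj
  have h := List.pairwise_iff_getElem.1 hΓ
  rcases lt_trichotomy i j with hlt | heq | hgt
  · exact (h i j hi1 hj1 hlt A ⟨he, he'⟩).elim
  · exact heq
  · exact (h j i hj1 hi1 hgt A ⟨he', he⟩).elim

theorem StronglyConsistent.absAtom_eq {Γ : Trail S} (hΓ : StronglyConsistent Γ) {i : ℕ}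
    {e : Entry S} {A : GAtom S} (hi : Γ[i]? = some e) (he : e.Defines A) :
    absAtom Γ A = (i : WithTop ℕ) := by
  classical
  have h : ∃ i : ℕ, ∃ e : Entry S, Γ[i]? = some e ∧ e.Defines A := ⟨i, e, hi, he⟩
  rw [absAtom, dif_pos h]
  obtain ⟨e', h1, h2⟩ := Nat.find_spec h
  rw [hΓ.index_eq hi h1 he h2]

theorem exists_of_absAtom_ne_top {Γ : Trail S} {A : GAtom S} (h : absAtom Γ A ≠ ⊤) :
    DefinedAtom Γ A := by
  classical
  rw [absAtom] at h
  split_ifs at h with h'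
  · obtain ⟨i, e, hi, he⟩ := h'
    exact ⟨e, List.mem_of_getElem? hi, he⟩
  · exact (h rfl).elim

theorem StronglyConsistent.exists_position {Γ : Trail S} (hΓ : StronglyConsistent Γ)
    {K : GLiteral S} (hK : FalseLit Γ K) :
    ∃ (i : ℕ) (e : Entry S), Γ[i]? = some e ∧ K.neg ∈ e.covered ∧
      absAtom Γ K.atom = (i : WithTop ℕ) := by
  obtain ⟨e, he, hKe⟩ := hK
  obtain ⟨i, hi⟩ := List.getElem?_of_mem he
  exact ⟨i, e, hi, hKe, hΓ.absAtom_eq hi (Entry.defines_of_neg_mem hKe)⟩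

/-- By consistency an atom is defined by one element only, so its position tells whether the literal
is already false in the prefix `Γ`. Together with its converse below, this translates between
falsity in prefixes and the abstract ordering. -/
theorem StronglyConsistent.falseLit_of_absAtom_lt {Γ Δ : Trail S}
    (hΓ : StronglyConsistent (Γ ++ Δ)) {K : GLiteral S} (hK : FalseLit (Γ ++ Δ) K)
    (h : absAtom (Γ ++ Δ) K.atom < (Γ.length : WithTop ℕ)) : FalseLit Γ K := by
  obtain ⟨i, e, hi, hKe, hi'⟩ := hΓ.exists_position hK
  rw [hi', Nat.cast_lt] at h
  rw [List.getElem?_append_left h] at hi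
  exact ⟨e, List.mem_of_getElem? hi, hKe⟩

theorem StronglyConsistent.absAtom_lt_of_falseLit {Γ Δ : Trail S}
    (hΓ : StronglyConsistent (Γ ++ Δ)) {K : GLiteral S} (hK : FalseLit Γ K) :
    absAtom (Γ ++ Δ) K.atom < (Γ.length : WithTop ℕ) := by
  obtain ⟨e, he, hKe⟩ := hK
  obtain ⟨i, hi, rfl⟩ := List.getElem_of_mem he
  have h : (Γ ++ Δ)[i]? = some Γ[i] := by
    rw [List.getElem?_append_left hi, List.getElem?_eq_getElem hi]
  rw [hΓ.absAtom_eq h (Entry.defines_of_neg_mem hKe)]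
  exact_mod_cast hi

theorem StronglyConsistent.absAtom_last {Γ : Trail S} {e : Entry S}
    (hΓ : StronglyConsistent (Γ ++ [e])) {A : GAtom S} (h : e.Defines A) :
    absAtom (Γ ++ [e]) A = (Γ.length : WithTop ℕ) :=
  hΓ.absAtom_eq (by simp) h

theorem StronglyConsistent.neg_mem_covered_last {Γ : Trail S} {e : Entry S}
    (hΓ : StronglyConsistent (Γ ++ [e])) {K : GLiteral S} (hK : FalseLit (Γ ++ [e]) K)
    (h : absAtom (Γ ++ [e]) K.atom = (Γ.length : WithTop ℕ)) : K.neg ∈ e.covered := by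
  rcases falseLit_concat.1 hK with h' | h'
  · exact absurd h (hΓ.absAtom_lt_of_falseLit h').ne
  · exact h'

/-- The interpretation induced by a trail falsifies the false literals. -/
theorem StronglyConsistent.not_satLit {Γ : Trail S} (hΓ : StronglyConsistent Γ) {K : GLiteral S}
    (hK : FalseLit Γ K) : ¬ SatLit (inducedInterp Γ) K := by
  obtain ⟨e, he, hKe⟩ := hK
  obtain ⟨b, A⟩ := K
  cases b with
  | false => exact fun h => absurd (h.2 ⟨e, he, hKe⟩) (by simp)
  | true =>
    intro h
    obtain ⟨e', he', hA⟩ := h.1 rfl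
    obtain ⟨i, hi⟩ := List.getElem?_of_mem he
    obtain ⟨j, hj⟩ := List.getElem?_of_mem he'
    -- Both elements define `A`, so they coincide; but a single element covers literals of one
    -- polarity only.
    obtain rfl := hΓ.index_eq hi hj ⟨_, hKe, rfl⟩ ⟨_, hA, rfl⟩
    rw [hi] at hj
    cases hj
    have h1 := Entry.pos_of_mem_covered hKe
    have h2 := Entry.pos_of_mem_covered hA
    rw [← h2] at h1
    simp [Lit.neg] at h1

/-- A defined literal or its complement is covered. Were the literal itself covered, it would be
satisfied; in the negative case this is `StronglyConsistent.not_satLit` for the complement. -/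
theorem falseLit_of_not_satLit {Γ : Trail S} {K : GLiteral S} (hK : DefinedAtom Γ K.atom)
    (hsat : ¬ SatLit (inducedInterp Γ) K)
    (hΓ : StronglyConsistent Γ) : FalseLit Γ K := by
  obtain ⟨e, he, hd⟩ := hK
  rcases Entry.mem_or_neg_mem_of_defines hd with h | h
  · refine (hsat ?_).elim
    by_contra hns
    obtain ⟨b, A⟩ := K
    cases b with
    | true => exact hns ⟨fun _ => ⟨e, he, h⟩, fun _ => rfl⟩
    | false =>
      refine hΓ.not_satLit (K := ⟨true, A⟩) ⟨e, he, h⟩ ⟨fun _ => ?_, fun _ => rfl⟩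
      by_contra hA
      exact hns ⟨fun h' => by simp at h', fun h' => (hA h').elim⟩
  · exact ⟨e, he, h⟩

/-- The reflexive closure of the comparison of abstracted ground clauses. -/
def AbsLE (Γ : Trail S) (H G : GClause S) : Prop :=
  ∃ X Y Z : Multiset (Lit (WithTop ℕ)), absClause Γ H = X + Y ∧ absClause Γ G = X + Z ∧
    ∀ y ∈ Y, ∃ z ∈ Z, litLT (· < ·) y z

theorem AbsLE.refl (Γ : Trail S) (G : GClause S) : AbsLE Γ G G :=
  ⟨absClause Γ G, 0, 0, by simp, by simp, by simp⟩

/-- The tie-break by `lt` is forgotten: the argument depends only on the positions of the defining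
trail elements. -/
theorem inducedLT.absLE {lt : GAtom S → GAtom S → Prop} {Γ : Trail S} {H G : GClause S}
    (h : inducedLT lt Γ H G) : AbsLE Γ H G := by
  rcases h with ⟨X, Y, Z, h1, h2, -, h3⟩ | ⟨h, -⟩
  · exact ⟨X, Y, Z, h1, h2, h3⟩
  · exact ⟨absClause Γ G, 0, 0, by simpa using h, by simp, by simp⟩

theorem AbsLE.exists_le {Γ : Trail S} {H G : GClause S} (h : AbsLE Γ H G) {K : GLiteral S}
    (hK : K ∈ H) : ∃ K' ∈ G, absAtom Γ K.atom ≤ absAtom Γ K'.atom := by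
  obtain ⟨X, Y, Z, h1, h2, h3⟩ := h
  have hmem : absLit Γ K ∈ X + Y := h1 ▸ Multiset.mem_map_of_mem _ hK
  have key : ∃ z ∈ X + Z, absAtom Γ K.atom ≤ z.atom := by
    rcases Multiset.mem_add.1 hmem with h | h
    · exact ⟨_, Multiset.mem_add.2 (Or.inl h), le_rfl⟩
    · obtain ⟨z, hz, hlt⟩ := h3 _ h
      refine ⟨z, Multiset.mem_add.2 (Or.inr hz), ?_⟩
      rcases hlt with hlt | ⟨heq, -⟩
      · exact hlt.le
      · exact heq.le
  obtain ⟨z, hz, hle⟩ := key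
  rw [← h2] at hz
  obtain ⟨K', hK', rfl⟩ := Multiset.mem_map.1 hz
  exact ⟨K', hK', hle⟩

/-- A redundant false clause has a false clause below it. -/
theorem RedundantG.exists_false {lt : GAtom S → GAtom S → Prop} {Γ : Trail S}
    (hΓ : StronglyConsistent Γ) {M : Set (GClause S)} {G : GClause S} (hG : FalseG Γ G)
    (h : RedundantG (inducedLT lt Γ) M G) : ∃ H ∈ M, FalseG Γ H ∧ AbsLE Γ H G := by
  rcases h with h | ⟨T, hT, hent⟩
  · exact ⟨G, h, hG, AbsLE.refl Γ G⟩
  · have hns : ¬ SatG (inducedInterp Γ) G := fun ⟨K, hK, hs⟩ => hΓ.not_satLit (hG K hK) hs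
    -- The induced interpretation is a countermodel to `G`, so it must also violate one of the
    -- clauses that entail `G`.
    have : ∃ H ∈ T, ¬ SatG (inducedInterp Γ) H := by
      by_contra hcon
      push Not at hcon
      exact hns (hent _ hcon)
    obtain ⟨H, hH, hHs⟩ := this
    obtain ⟨hHM, hlt⟩ := hT hH
    refine ⟨H, hHM, fun K hK => ?_, hlt.absLE⟩
    -- Undefined atoms are the largest ones, so a clause not above the false clause `G` has only
    -- defined atoms; being unsatisfied, its literals are false.
    refine falseLit_of_not_satLit (exists_of_absAtom_ne_top ?_) (fun hs => hHs ⟨K, hK, hs⟩) hΓ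
    obtain ⟨K', hK', hle⟩ := hlt.absLE.exists_le hK
    obtain ⟨i, -, -, -, hi⟩ := hΓ.exists_position (hG K' hK')
    rw [hi] at hle
    exact (hle.trans_lt (WithTop.coe_lt_top i)).ne

/-- Comparing two false clauses, the smaller of which is not false without the last element of
the trail. -/
theorem AbsLE.exists_last {Γ : Trail S} {e : Entry S} (hΓ : StronglyConsistent (Γ ++ [e]))
    {H G : GClause S} (hle : AbsLE (Γ ++ [e]) H G) (hH : FalseG (Γ ++ [e]) H)
    (hG : FalseG (Γ ++ [e]) G) (hH' : ¬ FalseG Γ H) :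
    ∃ (K : GLiteral S) (H₀ : GClause S) (X Y Z : Multiset (Lit (WithTop ℕ))),
      H = K ::ₘ H₀ ∧ K.neg ∈ e.covered ∧
      absClause (Γ ++ [e]) G = absLit (Γ ++ [e]) K ::ₘ (X + Z) ∧
      absClause (Γ ++ [e]) H₀ = X + Y ∧ ∀ y ∈ Y, ∃ z ∈ Z, litLT (· < ·) y z := by
  obtain ⟨X, Y, Z, h1, h2, h3⟩ := hle
  simp only [FalseG, not_forall] at hH'
  obtain ⟨K, hK, hKf⟩ := hH'
  have hKe : K.neg ∈ e.covered := (falseLit_concat.1 (hH K hK)).resolve_left hKf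
  have hKa := hΓ.absAtom_last (Entry.defines_of_neg_mem hKe)
  have hmem : absLit (Γ ++ [e]) K ∈ X + Y := h1 ▸ Multiset.mem_map_of_mem _ hK
  -- The abstraction of `K` is maximal among those of false literals: its position is the last one,
  -- and all literals falsified by `e` have the same polarity. So nothing in `Z` dominates it, and
  -- it belongs to the common part.
  have hX : absLit (Γ ++ [e]) K ∈ X := by
    refine (Multiset.mem_add.1 hmem).resolve_right fun hY => ?_
    obtain ⟨z, hz, hlt⟩ := h3 _ hY
    have hz' : z ∈ absClause (Γ ++ [e]) G := h2 ▸ Multiset.mem_add.2 (Or.inr hz)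
    obtain ⟨K', hK', rfl⟩ := Multiset.mem_map.1 hz'
    have hf := hG K' hK'
    rcases hlt with hlt | ⟨heq, hp, hp'⟩
    · change absAtom _ K.atom < absAtom _ K'.atom at hlt
      obtain ⟨i, e', hi, -, hi'⟩ := hΓ.exists_position hf
      rw [hKa, hi', Nat.cast_lt] at hlt
      obtain ⟨hi1, -⟩ := List.getElem?_eq_some_iff.1 hi
      simp at hi1
      omega
    · change absAtom _ K.atom = absAtom _ K'.atom at heq
      have h5 := Entry.pos_of_mem_covered (hΓ.neg_mem_covered_last hf (heq.symm.trans hKa))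
      rw [← Entry.pos_of_mem_covered hKe] at h5
      change K.pos = true at hp
      change K'.pos = false at hp'
      simp [Lit.neg, hp, hp'] at h5
  obtain ⟨H₀, rfl⟩ := Multiset.exists_cons_of_mem hK
  obtain ⟨X', rfl⟩ := Multiset.exists_cons_of_mem hX
  refine ⟨K, H₀, X', Y, Z, rfl, hKe, by rw [h2, Multiset.cons_add], ?_, h3⟩
  rw [absClause, Multiset.map_cons, Multiset.cons_add] at h1
  exact (Multiset.cons_inj_right _).1 h1

/-! ### Levels -/

theorem decisionLevels_append (Γ Δ : Trail S) :
    decisionLevels (Γ ++ Δ) = decisionLevels Γ ++ decisionLevels Δ := List.filterMap_append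

theorem exists_last_decision {Γ : Trail S} (h : decisionLevels Γ ≠ []) :
    ∃ (Γ₁ Γ₂ : Trail S) (L : Literal S) (π : Constraint S) (i : ℕ),
      Γ = Γ₁ ++ .decision L π i :: Γ₂ ∧ decisionLevels Γ₂ = [] := by
  induction Γ using List.reverseRecOn with
  | nil => exact (h rfl).elim
  | append_singleton Γ e ih =>
    cases e with
    | decision L π i => exact ⟨Γ, [], L, π, i, rfl, rfl⟩
    | deduced C L σ π =>
      rw [decisionLevels_append] at h
      obtain ⟨Γ₁, Γ₂, L', π', i, rfl, h2⟩ := ih (fun h' => h (by rw [h']; rfl))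
      exact ⟨Γ₁, Γ₂ ++ [.deduced C L σ π], L', π', i, by simp, by
        rw [decisionLevels_append, h2]; rfl⟩

theorem foldr_max_concat {l : List ℕ} {i : ℕ} (h : ∀ a ∈ l, a < i) :
    (l ++ [i]).foldr max 0 = i := by
  induction l with
  | nil => simp
  | cons a l ih =>
    rw [List.cons_append, List.foldr_cons, ih fun b hb => h b (List.mem_cons_of_mem _ hb)]
    exact max_eq_right (h a List.mem_cons_self).le

theorem trailLevel_eq {Γ₁ Γ₂ : Trail S} {L : Literal S} {π : Constraint S} {i : ℕ}
    (hord : (decisionLevels (Γ₁ ++ .decision L π i :: Γ₂)).Pairwise (· < ·))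
    (h₂ : decisionLevels Γ₂ = []) : trailLevel (Γ₁ ++ .decision L π i :: Γ₂) = i := by
  have h : decisionLevels (Γ₁ ++ .decision L π i :: Γ₂) = decisionLevels Γ₁ ++ [i] := by
    rw [decisionLevels_append]
    exact congrArg (fun l => decisionLevels Γ₁ ++ i :: l) h₂
  rw [h] at hord
  rw [trailLevel, h]
  exact foldr_max_concat fun a ha => (List.pairwise_append.1 hord).2.2 a ha i (by simp)

theorem lastLevel_eq {Γ₁ Γ₂ : Trail S} {L : Literal S} {π : Constraint S} {i : ℕ}
    (h₂ : decisionLevels Γ₂ = []) : lastLevel (Γ₁ ++ .decision L π i :: Γ₂) = i := by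
  have h : decisionLevels (Γ₁ ++ .decision L π i :: Γ₂) = decisionLevels Γ₁ ++ [i] := by
    rw [decisionLevels_append]
    exact congrArg (fun l => decisionLevels Γ₁ ++ i :: l) h₂
  rw [lastLevel, h]
  simp

/-- False literals without top-level are false before the last decision. -/
theorem absAtom_lt_of_not_topLevel {Γ₁ Γ₂ : Trail S} {L : Literal S} {π : Constraint S} {i : ℕ}
    (hΓ : StronglyConsistent (Γ₁ ++ .decision L π i :: Γ₂))
    (hord : (decisionLevels (Γ₁ ++ .decision L π i :: Γ₂)).Pairwise (· < ·))
    (h₂ : decisionLevels Γ₂ = []) {K : GLiteral S}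
    (hK : FalseLit (Γ₁ ++ .decision L π i :: Γ₂) K)
    (hl : ¬ LitHasLevel (Γ₁ ++ .decision L π i :: Γ₂) K
      (trailLevel (Γ₁ ++ .decision L π i :: Γ₂))) :
    absAtom (Γ₁ ++ .decision L π i :: Γ₂) K.atom < (Γ₁.length : WithTop ℕ) := by
  obtain ⟨m, e, hm, hKe, hm'⟩ := hΓ.exists_position hK
  rw [hm', Nat.cast_lt]
  by_contra hge
  push Not at hge
  refine hl ?_
  rw [trailLevel_eq hord h₂]
  obtain ⟨hm1, hm2⟩ := List.getElem?_eq_some_iff.1 hm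
  -- As `m ≥ Γ₁.length`, the prefix of length `m + 1` contains the last decision, and nothing after
  -- it is a decision; hence the level is `i`.
  have hsplit := List.take_append_drop m (Γ₁ ++ .decision L π i :: Γ₂)
  rw [List.drop_eq_getElem_cons hm1, hm2] at hsplit
  refine ⟨_, _, e, hsplit.symm, Entry.defines_of_neg_mem hKe, ?_⟩
  rw [← hm2, List.take_append_getElem hm1, List.take_append, List.take_of_length_le (by omega),
    show m + 1 - Γ₁.length = (m - Γ₁.length) + 1 by omega, List.take_succ_cons]
  refine lastLevel_eq ?_
  have := ((List.take_sublist (m - Γ₁.length) Γ₂).filterMap Entry.level?)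
  change List.Sublist _ (decisionLevels Γ₂) at this
  rw [h₂] at this
  exact List.sublist_nil.1 this

/-- The defining element precedes the decision of level `i`, so its level is that of an earlier,
hence smaller, decision, or the default 0, which `1 ≤ i` excludes. -/
theorem not_litHasLevel_of_absAtom_lt {Γ : Trail S} {L : Literal S} {π : Constraint S} {i : ℕ}
    (hΓ : StronglyConsistent (Γ ++ [.decision L π i]))
    (hord : (decisionLevels (Γ ++ [.decision L π i])).Pairwise (· < ·)) (hi : 1 ≤ i)
    {K : GLiteral S}
    (hK : absAtom (Γ ++ [.decision L π i]) K.atom < (Γ.length : WithTop ℕ)) :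
    ¬ LitHasLevel (Γ ++ [.decision L π i]) K i := by
  rintro ⟨Γ₁, Γ₂, e, heq, he, hl⟩
  have hpos := hΓ.absAtom_eq (i := Γ₁.length) (e := e) (by rw [heq]; simp) he
  rw [hpos, Nat.cast_lt] at hK
  have hpre : Γ₁ ++ [e] <+: Γ := by
    refine List.prefix_of_prefix_length_le (l₃ := Γ ++ [.decision L π i]) ?_ ?_ (by simp; omega)
    · rw [heq]; exact ⟨Γ₂, by simp⟩
    · exact List.prefix_append _ _
  obtain ⟨Δ, rfl⟩ := hpre
  rw [decisionLevels_append, decisionLevels_append] at hord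
  have hlt := (List.pairwise_append.1 hord).2.2
  have : lastLevel (Γ₁ ++ [e]) < i := by
    rw [lastLevel]
    rcases hd : (decisionLevels (Γ₁ ++ [e])).getLast? with _ | a
    · exact hi
    · exact hlt a (List.mem_append_left _ (List.mem_of_getLast? hd)) i
        (List.mem_singleton.2 rfl)
  omega

/-! ### Applicability of the rules -/

/-- The ground instance itself can be propagated: with a ground substitution and the trivial
constraint, all conditions of the rule become ground statements. -/
theorem exists_propagateCond {Γ : Trail S} {N U : Set (Clause S)}
    {K : GLiteral S} {H : GClause S} (hmem : K ::ₘ H ∈ gndSet (N ∪ U)) (hH : FalseG Γ H)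
    (hK : ¬ DefinedAtom Γ K.atom) :
    ∃ (C : Clause S) (L : Literal S) (σ : Subst S) (π : Constraint S),
      PropagateCond Γ N U C L σ π := by
  obtain ⟨D, hD, δ, hδ⟩ := hmem
  have hKD : K ∈ clauseGround δ D := hδ ▸ Multiset.mem_cons_self K H
  obtain ⟨L, hL, rfl⟩ := Multiset.mem_map.1 hKD
  obtain ⟨C, rfl⟩ := Multiset.exists_cons_of_mem hL
  rw [clauseGround, Multiset.map_cons, Multiset.cons_inj_right] at hδ
  refine ⟨C, L, constSubst δ, .top, hD, ?_, ?_, ?_, ?_⟩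
  · rintro x ⟨d, hd, -⟩
    simp at hd
  · rintro G ⟨ε, -, rfl⟩
    rw [clauseGround_clauseSubst, groundComp_constSubst, clauseGround, ← hδ]
    exact hH
  · rintro G ⟨ε, -, rfl⟩
    rw [litGround_litSubst, groundComp_constSubst]
    exact hK
  · exact ⟨_, δ, Constraint.solves_top δ, rfl⟩

/-- A nonempty clause with a false instance permits Conflict with a ground substitution; the empty
clause, which Conflict excludes, is left to Failure. -/
theorem not_hasFalseInstance_of_not_applicable {Γ : Trail S} {N U : Set (Clause S)} {k : ℤ}
    (hk : 0 ≤ k) (hf : ¬ Applicable .failure ⟨Γ, N, U, k, .top⟩)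
    (hc : ¬ Applicable .conflict ⟨Γ, N, U, k, .top⟩) :
    ∀ C ∈ N ∪ U, ¬ HasFalseInstance Γ C := by
  rintro C hC ⟨_, ⟨δ, rfl⟩, hG⟩
  by_cases h0 : C = 0
  · subst h0
    exact hf ⟨_, Failure.mk _ _ _ _ hC⟩
  · refine hc ⟨_, Conflict.mk Γ N U k C (constSubst δ) .top hk hC h0 ?_ ?_⟩
    · rintro G ⟨ε, -, rfl⟩
      rw [clauseGround_clauseSubst, groundComp_constSubst]
      exact hG
    · exact ⟨_, δ, Constraint.solves_top δ, rfl⟩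

/-- After renaming apart, the two groundings merge into one ground unifier `θ`. It factors through a
most general unifier, and as it solves both constraints, it witnesses that the unified instance is
not empty. -/
theorem touches_of_neg_mem_covered {e₀ : Entry S} {C : Clause S} {σ : Subst S}
    {π : Constraint S} {δ : ℕ → S.Const} (hδ : π.Solves δ) {L : Literal S} (hL : L ∈ C)
    (h : (litGround δ (litSubst σ L)).neg ∈ e₀.covered) : Touches e₀ C σ π := by
  obtain ⟨δ', hδ', hK⟩ := h
  obtain ⟨e, he, hdisj, θ, hθ, hθe, hθK⟩ := e₀.exists_variant
    ((finite_clauseVars (clauseSubst σ C)).union π.finite_lvars) δ δ' hδ'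
  have hLθ : litGround θ (litSubst σ L) = litGround δ (litSubst σ L) :=
    litGround_congr fun x hx => hθ x (Or.inl ⟨_, Multiset.mem_map_of_mem _ hL, hx⟩)
  have heq : litGround θ e.lit = litGround θ (litSubst σ L).neg := by
    rw [hθK, ← hK, litGround_neg, hLθ]
  obtain ⟨η, hη, τ, hτ⟩ := exists_isMGU_of_ground (E := {e.lit, (litSubst σ L).neg}) (θ := θ) (by
    rintro K (rfl | rfl) K' (rfl | rfl)
    exacts [rfl, heq, heq.symm, rfl])
  refine ⟨e, he, hdisj, L, hL, η, hη, _, τ, ?_, rfl⟩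
  rw [Constraint.solves_and, Constraint.solves_subst, Constraint.solves_subst, hτ]
  exact ⟨Constraint.solves_congr (fun x hx => (hθ x (Or.inr hx)).symm) hδ, hθe⟩

/-- Two occurrences of the same ground literal come from two literals of `C` that `δ` unifies after
`σ`; the rest is the lifting argument of `touches_of_neg_mem_covered`, now for three literals. -/
theorem factorize_of_duplicate {Γ : Trail S} {N U : Set (Clause S)} {k : ℤ} {e₀ : Entry S}
    {C : Clause S} {σ : Subst S} {π : Constraint S} {δ : ℕ → S.Const} (hδ : π.Solves δ)
    {K : GLiteral S} {G : GClause S}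
    (hG : clauseGround δ (clauseSubst σ C) = K ::ₘ K ::ₘ G) (hK : K.neg ∈ e₀.covered) :
    ∃ s : State S, Factorize ⟨Γ ++ [e₀], N, U, k, .conflict C σ π⟩ s := by
  have hsplit : ∃ (L₁ L₂ : Literal S) (C' : Clause S), C = L₁ ::ₘ L₂ ::ₘ C' ∧
      litGround δ (litSubst σ L₁) = K ∧ litGround δ (litSubst σ L₂) = K := by
    rw [clauseGround, clauseSubst, Multiset.map_map] at hG
    obtain ⟨L₁, h1, h1K⟩ := Multiset.mem_map.1 (hG ▸ Multiset.mem_cons_self _ _)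
    obtain ⟨C₁, rfl⟩ := Multiset.exists_cons_of_mem h1
    rw [Multiset.map_cons, h1K, Multiset.cons_inj_right] at hG
    obtain ⟨L₂, h2, h2K⟩ := Multiset.mem_map.1 (hG ▸ Multiset.mem_cons_self _ _)
    obtain ⟨C₂, rfl⟩ := Multiset.exists_cons_of_mem h2
    exact ⟨L₁, L₂, C₂, rfl, h1K, h2K⟩
  obtain ⟨L₁, L₂, C, rfl, h1, h2⟩ := hsplit
  obtain ⟨δ', hδ', hK'⟩ := hK
  obtain ⟨e, he, hdisj, θ, hθ, hθe, hθK⟩ := e₀.exists_variant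
    ((finite_clauseVars (clauseSubst σ (L₁ ::ₘ L₂ ::ₘ C))).union π.finite_lvars) δ δ' hδ'
  have hLθ : ∀ L ∈ L₁ ::ₘ L₂ ::ₘ C,
      litGround θ (litSubst σ L) = litGround δ (litSubst σ L) := fun L hL =>
    litGround_congr fun x hx => hθ x (Or.inl ⟨_, Multiset.mem_map_of_mem _ hL, hx⟩)
  have hall : ∀ M ∈ ({litSubst σ L₁, litSubst σ L₂, e.lit.neg} : Set (Literal S)),
      litGround θ M = K := by
    rintro M (rfl | rfl | rfl)
    · rw [hLθ _ (by simp), h1]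
    · rw [hLθ _ (by simp), h2]
    · rw [litGround_neg, hθK, ← hK', Lit.neg_neg]
  obtain ⟨η, hη, τ, hτ⟩ := exists_isMGU_of_ground (θ := θ)
    fun M hM M' hM' => (hall M hM).trans (hall M' hM').symm
  -- The composition of `σ` and `η` unifies `L₁` and `L₂` before instantiation, so it factors
  -- through `η₀`; the second factor is `σs`.
  have hunif : ∀ M ∈ ({L₁, L₂} : Set (Literal S)), ∀ M' ∈ ({L₁, L₂} : Set (Literal S)),
      litSubst (fun x => (σ x).subst η) M = litSubst (fun x => (σ x).subst η) M' := by
    intro M hM M' hM'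
    rw [← litSubst_litSubst, ← litSubst_litSubst]
    refine hη.1 _ ?_ _ ?_
    · rcases hM with rfl | rfl <;> simp
    · rcases hM' with rfl | rfl <;> simp
  obtain ⟨η₀, hη₀⟩ := exists_isMGU hunif
  obtain ⟨σs, hσs⟩ := hη₀.2 _ hunif
  refine ⟨_, Factorize.mk Γ N U k e₀ e C L₁ L₂ σ π η η₀ σs (π.subst η) he hdisj hη hη₀
    (fun x _ => (hσs x).symm) ⟨_, τ, ?_, rfl⟩ fun _ => Iff.rfl⟩
  rw [Constraint.solves_and, Constraint.solves_subst, Constraint.solves_subst, hτ]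
  exact ⟨Constraint.solves_congr (fun x hx => (hθ x (Or.inr hx)).symm) hδ, hθe⟩

/-! ### Regularity is preserved by conflict search -/

theorem append_cons_eq_concat {α : Type*} {l l₁ l₂ : List α} {a b : α}
    (h : l ++ [b] = l₁ ++ a :: l₂) :
    (l = l₁ ∧ b = a) ∨ ∃ l₃, l = l₁ ++ a :: l₃ := by
  rcases List.eq_nil_or_concat' l₂ with rfl | ⟨l₃, c, rfl⟩
  · obtain ⟨h1, h2⟩ := List.append_inj' h rfl
    exact Or.inl ⟨h1, (List.cons.inj h2).1⟩
  · refine Or.inr ⟨l₃, ?_⟩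
    have h' : l ++ [b] = (l₁ ++ a :: l₃) ++ [c] := by simpa using h
    exact (List.append_inj' h' rfl).1

/-- There are exactly `k` decisions and each of the levels `1, …, k` occurs, so by counting no other
level does. -/
theorem WellFormed.level_bounds {Γ : Trail S} {N U : Set (Clause S)} {k : ℤ}
    (h : WellFormed Γ N U k) (hk : 0 ≤ k) {a : ℕ} (ha : a ∈ decisionLevels Γ) :
    1 ≤ a ∧ (a : ℤ) ≤ k := by
  have hsub : Finset.Icc 1 k.toNat ⊆ (decisionLevels Γ).toFinset := by
    intro i hi
    rw [Finset.mem_Icc] at hi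
    have := h.unique i hi.1 (by omega)
    rw [List.mem_toFinset]
    exact List.count_pos_iff.1 (by omega)
  have hcard : (decisionLevels Γ).toFinset.card ≤ (Finset.Icc 1 k.toNat).card := by
    refine (List.toFinset_card_le _).trans ?_
    have := h.count hk
    rw [Nat.card_Icc]
    omega
  have hmem : a ∈ Finset.Icc 1 k.toNat := by
    rw [Finset.eq_of_subset_of_card_le hsub hcard]
    exact List.mem_toFinset.2 ha
  rw [Finset.mem_Icc] at hmem
  omega

theorem stronglyConsistent_concat {Γ : Trail S} {e : Entry S} (hΓ : StronglyConsistent Γ)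
    (he : UndefinedLit Γ e.lit e.constr) : StronglyConsistent (Γ ++ [e]) := by
  refine List.pairwise_append.2 ⟨hΓ, List.pairwise_singleton _ _, fun e' he' e'' h'' A hA => ?_⟩
  obtain rfl := List.mem_singleton.1 h''
  obtain ⟨K, hK, rfl⟩ := hA.2
  exact he K hK ⟨e', he', hA.1⟩

theorem Regular.propagate {Γ : Trail S} {N U : Set (Clause S)} {k : ℤ} {C : Clause S}
    {L : Literal S} {σ : Subst S} {π : Constraint S} (h : Regular ⟨Γ, N, U, k, .top⟩)
    (hk : 0 ≤ k) (hp : PropagateCond Γ N U C L σ π)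
    (hnf : ∀ C ∈ N ∪ U, ¬ HasFalseInstance Γ C) :
    Regular ⟨Γ ++ [.deduced C L σ π], N, U, k, .top⟩ := by
  have hs := h.sound
  have hw := hs.wellFormed
  have hlev : decisionLevels (Γ ++ [.deduced C L σ π]) = decisionLevels Γ := by
    rw [decisionLevels_append]; exact List.append_nil _
  refine ⟨⟨stronglyConsistent_concat hs.consistent hp.2.2.2.1, ⟨?_, ?_, ?_, ?_, ?_⟩, hs.learned,
    nofun, ?_, nofun⟩, ?_, ?_⟩
  · rw [hlev]; exact hw.count
  · rw [hlev]; exact hw.unique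
  · rw [hlev]; exact hw.order
  · intro Γ₁ Γ₂ L' π' i heq
    rcases append_cons_eq_concat heq with ⟨-, h'⟩ | ⟨Γ₃, h'⟩
    · cases h'
    · exact hw.decision Γ₁ Γ₃ L' π' i h'
  · intro Γ₁ Γ₂ C' L' σ' π' heq
    rcases append_cons_eq_concat heq with ⟨rfl, h'⟩ | ⟨Γ₃, h'⟩
    · cases h'; exact hp
    · exact hw.deduced Γ₁ Γ₃ C' L' σ' π' h'
  · intro h1
    change k = -1 at h1
    omega
  · intro Γ' e heq
    obtain ⟨rfl, -⟩ := List.append_inj' heq rfl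
    exact hnf
  · intro Γ₁ Γ₂ L' π' i heq
    rcases append_cons_eq_concat heq with ⟨-, h'⟩ | ⟨Γ₃, h'⟩
    · cases h'
    · exact h.exhausted Γ₁ Γ₃ L' π' i h'

theorem Regular.decide {Γ : Trail S} {N U : Set (Clause S)} {k : ℤ}
    {L : Literal S} {π : Constraint S} {i : ℕ} (h : Regular ⟨Γ, N, U, k, .top⟩)
    (hk : 0 ≤ k) (hi : (i : ℤ) = k + 1) (hd : DecideCond Γ N U L π)
    (hnf : ∀ C ∈ N ∪ U, ¬ HasFalseInstance Γ C)
    (hnp : ∀ C K σ π', ¬ PropagateCond Γ N U C K σ π') :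
    Regular ⟨Γ ++ [.decision L π i], N, U, k + 1, .top⟩ := by
  have hs := h.sound
  have hw := hs.wellFormed
  have hb := fun a (ha : a ∈ decisionLevels Γ) => hw.level_bounds hk ha
  have hlev : decisionLevels (Γ ++ [.decision L π i]) = decisionLevels Γ ++ [i] := by
    rw [decisionLevels_append]; rfl
  refine ⟨⟨stronglyConsistent_concat hs.consistent hd.2.1, ⟨?_, ?_, ?_, ?_, ?_⟩, hs.learned,
    nofun, ?_, nofun⟩, ?_, ?_⟩
  · intro _
    have := hw.count hk
    simp only at this ⊢
    rw [hlev, List.length_append, List.length_singleton]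
    push_cast
    omega
  · intro j hj1 hj2
    simp only at hj2 ⊢
    rw [hlev, List.count_append]
    by_cases hij : j = i
    · subst hij
      rw [List.count_singleton_self, List.count_eq_zero_of_not_mem]
      intro hmem
      have : (j : ℤ) ≤ k := (hb j hmem).2
      omega
    · rw [hw.unique j hj1 (by simp only; omega), List.count_eq_zero_of_not_mem]
      simpa using hij
  · rw [hlev]
    refine List.pairwise_append.2 ⟨hw.order, List.pairwise_singleton _ _, fun a ha b hb' => ?_⟩
    obtain rfl := List.mem_singleton.1 hb'
    have : (a : ℤ) ≤ k := (hb a ha).2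
    omega
  · intro Γ₁ Γ₂ L' π' j heq
    rcases append_cons_eq_concat heq with ⟨rfl, h'⟩ | ⟨Γ₃, h'⟩
    · cases h'; exact hd
    · exact hw.decision Γ₁ Γ₃ L' π' j h'
  · intro Γ₁ Γ₂ C' L' σ' π' heq
    rcases append_cons_eq_concat heq with ⟨-, h'⟩ | ⟨Γ₃, h'⟩
    · cases h'
    · exact hw.deduced Γ₁ Γ₃ C' L' σ' π' h'
  · intro h1
    change k + 1 = -1 at h1
    omega
  · intro Γ' e heq
    obtain ⟨rfl, -⟩ := List.append_inj' heq rfl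
    exact hnf
  · intro Γ₁ Γ₂ L' π' j heq
    rcases append_cons_eq_concat heq with ⟨rfl, h'⟩ | ⟨Γ₃, h'⟩
    · exact hnp
    · exact h.exhausted Γ₁ Γ₃ L' π' j h'

/-- The two admissible strategies place Success differently; only precedences common to both are
used. -/
theorem IsRegularRun.not_applicable {st : ℕ → State S} {rule : ℕ → Rule} {len : ℕ∞}
    (h : IsRegularRun st rule len) {l : ℕ} (hl : (l : ℕ∞) < len) {r : Rule}
    (h₁ : r ∈ before (rule l)) (h₂ : r ∈ beforeAlt (rule l)) : ¬ Applicable r (st l) := by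
  rcases h.search with h | h
  · exact h l hl r h₁
  · exact h l hl r h₂

/-- The states of conflict search in a regular run are regular. -/
theorem IsRegularRun.regular {st : ℕ → State S} {rule : ℕ → Rule} {len : ℕ∞}
    (h : IsRegularRun st rule len) (l : ℕ) (hl : (l : ℕ∞) < len) (htop : (st l).ind = .top)
    (hk : 0 ≤ (st l).k) : Regular (st l) := by
  induction l with
  | zero => exact h.start
  | succ l ih =>
    have hl' : (l : ℕ∞) < len := lt_of_le_of_lt (by exact_mod_cast l.le_succ) hl
    have ih := ih hl'
    have hstep := h.steps l hl'
    have hback := h.backtrack l hl'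
    have hna := fun r => h.not_applicable hl' (r := r)
    generalize st l = s at *
    generalize st (l + 1) = s' at *
    generalize rule l = r at *
    cases r with
    | propagate =>
      cases hstep with
      | mk Γ N U k C L σ π hk' hp =>
        exact (ih rfl hk').propagate hk' hp (not_hasFalseInstance_of_not_applicable hk'
          (hna _ (by simp [before]) (by simp [beforeAlt]))
          (hna _ (by simp [before]) (by simp [beforeAlt])))
    | decide =>
      cases hstep with
      | mk Γ N U k L π i hk' hi hd =>
        refine (ih rfl hk').decide hk' hi hd (not_hasFalseInstance_of_not_applicable hk'
          (hna _ (by simp [before]) (by simp [beforeAlt]))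
          (hna _ (by simp [before]) (by simp [beforeAlt]))) fun C K σ π' hp => ?_
        exact hna .propagate (by simp [before]) (by simp [beforeAlt])
          ⟨_, Propagate.mk Γ N U k C K σ π' hk' hp⟩
    | conflict => cases hstep; cases htop
    | success => cases hstep; exact absurd hk (by simp)
    | failure => cases hstep; cases htop
    | skip => cases hstep; cases htop
    | resolve => cases hstep; cases htop
    | factorize => cases hstep; cases htop
    | backjump => exact hback rfl

/-! ### Conflict resolution -/

/-- The states of conflict resolution that starts from the trail `Γ`. -/
def IsConflictState (Γ : Trail S) (N U : Set (Clause S)) (k : ℤ) (s : State S) : Prop :=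
  ∃ (Γ' Δ : Trail S) (C : Clause S) (σ : Subst S) (π : Constraint S),
    s = ⟨Γ', N, U, k, .conflict C σ π⟩ ∧ Γ = Γ' ++ Δ ∧ FalseClause Γ' (clauseSubst σ C) π ∧
    (gndClause (clauseSubst σ C) π).Nonempty ∧
    (Δ = [] → ∀ (Γ₀ : Trail S) (L : Literal S) (π' : Constraint S) (i : ℕ),
      Γ = Γ₀ ++ [.decision L π' i] → ∀ G ∈ gndClause (clauseSubst σ C) π, ∀ K₁ ∈ G, ∀ K₂ ∈ G,
        K₁.neg ∈ gndLit L π' → K₂.neg ∈ gndLit L π' → K₁ = K₂)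

/-- The final condition of the invariant holds at the start since a decision that ends the trail is
not blocked: two different literals of an instance, both falsified by it, would make the conflict
clause a blocking clause. -/
theorem isConflictState_of_conflict {Γ : Trail S} {N U : Set (Clause S)} {k : ℤ}
    (hw : WellFormed Γ N U k) {s' : State S}
    (h : Conflict ⟨Γ, N, U, k, .top⟩ s') : IsConflictState Γ N U k s' := by
  cases h with
  | mk _ _ _ _ C σ π hk hC hne hf hg =>
    refine ⟨Γ, [], C, σ, π, rfl, (List.append_nil Γ).symm, hf, hg, ?_⟩
    rintro - Γ₀ L π' i rfl G hG K₁ hK₁ K₂ hK₂ h1 h2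
    by_contra hne'
    have hd := hw.decision Γ₀ [] L π' i rfl
    exact hd.2.2.1 C hC ⟨hd.2.1, G, gndClause_subset_gnd _ _ _ hG, K₁, hK₁, K₂, hK₂,
      fun K hK => falseLit_concat.1 (hf G hG K hK), h1, h2, hne'⟩

/-- This is what makes Skip harmless: an instance that needs `e` in order to be false would be a
touch. -/
theorem falseClause_of_not_touches {Γ : Trail S} {e : Entry S} {C : Clause S} {σ : Subst S}
    {π : Constraint S} (hf : FalseClause (Γ ++ [e]) (clauseSubst σ C) π)
    (h : ¬ Touches e C σ π) : FalseClause Γ (clauseSubst σ C) π := by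
  rintro G ⟨δ, hδ, rfl⟩ K hK
  refine (falseLit_concat.1 (hf _ ⟨δ, hδ, rfl⟩ K hK)).resolve_right fun hKe => h ?_
  obtain ⟨L', hL', rfl⟩ := Multiset.mem_map.1 hK
  obtain ⟨L, hL, rfl⟩ := Multiset.mem_map.1 hL'
  exact touches_of_neg_mem_covered hδ hL hKe

/-- The ground form of the condition on `σ*`: instances of the new conflict clause consist of
instances of its parents. -/
theorem clauseGround_clauseSubst_eq {η₀ σs σ η : Subst S} {D : Clause S}
    (h : ∀ x ∈ clauseVars D, (η₀ x).subst σs = (σ x).subst η) (δ : ℕ → S.Const) :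
    clauseGround δ (clauseSubst σs (clauseSubst η₀ D)) =
      clauseGround (groundComp η δ) (clauseSubst σ D) := by
  rw [clauseGround_clauseSubst, clauseGround_clauseSubst, clauseGround_clauseSubst]
  refine clauseGround_congr fun x hx => ?_
  have := congrArg (Term.ground δ) (h x hx)
  rwa [Term.ground_subst, Term.ground_subst] at this

theorem clauseVars_mono {C D : Clause S} (h : C ≤ D) : clauseVars C ⊆ clauseVars D :=
  fun _ ⟨L, hL, hx⟩ => ⟨L, Multiset.mem_of_le h hL, hx⟩

theorem clauseGround_le (δ : ℕ → S.Const) {C D : Clause S} (h : C ≤ D) :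
    clauseGround δ C ≤ clauseGround δ D := Multiset.map_le_map h

theorem clauseSubst_le (σ : Subst S) {C D : Clause S} (h : C ≤ D) :
    clauseSubst σ C ≤ clauseSubst σ D := Multiset.map_le_map h

theorem gndClause_rename (ρ : Equiv.Perm ℕ) (C : Clause S) (π : Constraint S) :
    gndClause (clauseSubst (permSubst S ρ) C) (π.subst (permSubst S ρ)) ⊆ gndClause C π := by
  rintro G ⟨δ, hδ, rfl⟩
  exact ⟨_, (Constraint.solves_subst _ _ _).1 hδ, clauseGround_clauseSubst _ _ _⟩

/-- Side literals of a variant of a deduced literal are false. -/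
theorem WellFormed.falseClause_of_isVariant {Γ Δ : Trail S} {N U : Set (Clause S)} {k : ℤ}
    {e₀ : Entry S} (hw : WellFormed (Γ ++ e₀ :: Δ) N U k) {C : Clause S} {L : Literal S}
    {σ : Subst S} {π : Constraint S} (h : Entry.IsVariant (.deduced C L σ π) e₀) :
    FalseClause Γ (clauseSubst σ C) π := by
  obtain ⟨ρ, hρ⟩ := h
  cases e₀ with
  | decision => cases hρ
  | deduced C₀ L₀ σ₀ π₀ =>
    cases hρ
    have hp := hw.deduced Γ Δ C₀ L₀ σ₀ π₀ rfl
    intro G hG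
    rw [clauseSubst_rename] at hG
    exact hp.2.2.1 G (gndClause_rename ρ _ _ hG)

theorem IsConflictState.step {Γ : Trail S} {N U : Set (Clause S)} {k : ℤ}
    (hw : WellFormed Γ N U k) {s s' : State S} (hs : IsConflictState Γ N U k s) {r : Rule}
    (hr : r ≠ .backjump) (hstep : Step r s s') : IsConflictState Γ N U k s' := by
  obtain ⟨Γ', Δ, C, σ, π, rfl, rfl, hf, hne, hdec⟩ := hs
  cases r with
  | propagate => cases hstep
  | decide => cases hstep
  | conflict => cases hstep
  | success => cases hstep
  | failure => cases hstep
  | backjump => exact (hr rfl).elim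
  | skip =>
    generalize hs : (State.mk Γ' N U k (.conflict C σ π)) = s at hstep
    cases hstep with
    | mk Γ₁ _ _ _ C' L' σ' π' _ _ _ ht =>
      cases hs
      exact ⟨Γ₁, .deduced C' L' σ' π' :: Δ, C, σ, π, rfl, by simp,
        falseClause_of_not_touches hf ht, hne, nofun⟩
  | resolve =>
    generalize hs : (State.mk Γ' N U k (.conflict C σ π)) = s at hstep
    cases hstep with
    | mk Γ₁ _ _ _ e₀ C' L' σ' π' D L _ _ η η₀ σs πs hvar _ _ _ _ _ hσ hσ' hne' hπ =>
      cases hs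
      refine ⟨Γ₁ ++ [e₀], Δ, _, σs, πs, rfl, rfl, ?_, ?_, ?_⟩
      · rintro G ⟨δ, hδ, rfl⟩
        rw [hπ δ, Constraint.solves_and, Constraint.solves_subst, Constraint.solves_subst] at hδ
        have h1 := clauseGround_clauseSubst_eq (D := D) (fun x hx =>
          hσ x (clauseVars_mono (Multiset.le_cons_self _ _) hx)) δ
        have h2 := clauseGround_clauseSubst_eq (D := C') (fun x hx =>
          hσ' x (clauseVars_mono (Multiset.le_cons_self _ _) hx)) δ
        have h3 : clauseGround δ (clauseSubst σs (clauseSubst η₀ (D + C'))) =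
            clauseGround (groundComp η δ) (clauseSubst σ D) +
              clauseGround (groundComp η δ) (clauseSubst σ' C') := by
          rw [← h1, ← h2]; simp [clauseGround, clauseSubst]
        rw [h3]
        intro K hK
        rcases Multiset.mem_add.1 hK with hK | hK
        · exact hf _ ⟨_, hδ.1, rfl⟩ K (Multiset.mem_of_le (clauseGround_le _
            (clauseSubst_le _ (Multiset.le_cons_self _ _))) hK)
        -- The side literals of the reason were already false when `e₀` was propagated.
        · have hw' : WellFormed (Γ₁ ++ e₀ :: Δ) N U k := by simpa using hw
          exact FalseLit.append (hw'.falseClause_of_isVariant hvar _ ⟨_, hδ.2, rfl⟩ K hK) _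
      · obtain ⟨_, δ, hδ, -⟩ := hne'
        exact ⟨_, δ, (hπ δ).2 hδ, rfl⟩
      -- The resolved element is a variant of a deduced literal, so the trail does not end with a
      -- decision and the condition is vacuous.
      · rintro rfl Γ₀ L₀ π₀ i heq
        rw [List.append_nil] at heq
        obtain ⟨-, he⟩ := List.append_inj' heq rfl
        obtain rfl := (List.cons.inj he).1
        obtain ⟨ρ, hρ⟩ := hvar
        cases hρ
  | factorize =>
    generalize hs : (State.mk Γ' N U k (.conflict C σ π)) = s at hstep
    cases hstep with
    | mk Γ₁ _ _ _ e₀ e D L₁ L₂ _ _ η η₀ σs πs hvar _ _ _ hσ hne' hπ =>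
      cases hs
      have hle : L₁ ::ₘ D ≤ L₁ ::ₘ L₂ ::ₘ D :=
        Multiset.cons_le_cons _ (Multiset.le_cons_self _ _)
      -- Factorization only drops a literal: each new instance is a submultiset of an old one, and
      -- thus inherits falsity and the condition on the last decision.
      have key : ∀ G ∈ gndClause (clauseSubst σs (clauseSubst η₀ (L₁ ::ₘ D))) πs,
          ∃ G' ∈ gndClause (clauseSubst σ (L₁ ::ₘ L₂ ::ₘ D)) π, G ≤ G' := by
        rintro G ⟨δ, hδ, rfl⟩
        rw [hπ δ, Constraint.solves_subst] at hδ
        refine ⟨_, ⟨_, hδ, rfl⟩, ?_⟩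
        rw [clauseGround_clauseSubst_eq (fun x hx => hσ x (clauseVars_mono hle hx))]
        exact clauseGround_le _ (clauseSubst_le _ hle)
      refine ⟨Γ₁ ++ [e₀], Δ, _, σs, πs, rfl, rfl, ?_, ?_, ?_⟩
      · intro G hG K hK
        obtain ⟨G', hG', hGG'⟩ := key G hG
        exact hf G' hG' K (Multiset.mem_of_le hGG' hK)
      · obtain ⟨_, δ, hδ, -⟩ := hne'
        exact ⟨_, δ, (hπ δ).2 ((Constraint.solves_and _ _ _).1 hδ).1, rfl⟩
      · intro hΔ Γ₀ L π' i heq G hG K₁ hK₁ K₂ hK₂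
        obtain ⟨G', hG', hGG'⟩ := key G hG
        exact hdec hΔ Γ₀ L π' i heq G' hG' K₁ (Multiset.mem_of_le hGG' hK₁) K₂
          (Multiset.mem_of_le hGG' hK₂)

/-! ### Non-redundancy of false clauses -/

/-- With nothing below the empty clause, it would have to follow from no premises at all; but every
interpretation, here `∅`, violates it. -/
theorem not_redundantG_zero {r : GClause S → GClause S → Prop} {M : Set (GClause S)}
    (h0 : (0 : GClause S) ∉ M) (hr : ∀ H, ¬ r H 0) : ¬ RedundantG r M 0 := by
  rintro (h | ⟨T, hT, hent⟩)
  · exact h0 h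
  · obtain ⟨K, hK, -⟩ := hent ∅ fun H hH => (hr H (hT hH).2).elim
    exact Multiset.notMem_zero K hK

theorem not_inducedLT_zero (lt : GAtom S → GAtom S → Prop) (Γ : Trail S) (H : GClause S) :
    ¬ inducedLT lt Γ H 0 := by
  rintro (h | ⟨-, h⟩)
  · obtain ⟨X, Y, Z, -, h2, hZ, -⟩ := h
    exact hZ (add_eq_zero.1 h2.symm).2
  · obtain ⟨X, Y, Z, -, h2, hZ, -⟩ := h
    exact hZ (add_eq_zero.1 h2.symm).2

/-- A redundant clause that is false under the trail of a regular state contains a literal of the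
last element, and there is a clause with a unique greatest such literal below it. -/
theorem Regular.exists_last_of_redundantG {lt : GAtom S → GAtom S → Prop} {Γ : Trail S}
    {e : Entry S} {N U : Set (Clause S)} {k : ℤ} {s : Indicator S}
    (h : Regular ⟨Γ ++ [e], N, U, k, s⟩) {G : GClause S} (hG : FalseG (Γ ++ [e]) G)
    (hred : RedundantG (inducedLT lt (Γ ++ [e])) (gndSet (N ∪ U)) G) :
    ∃ (K : GLiteral S) (H₀ : GClause S) (X Y Z : Multiset (Lit (WithTop ℕ))),
      K ::ₘ H₀ ∈ gndSet (N ∪ U) ∧ FalseG (Γ ++ [e]) (K ::ₘ H₀) ∧ K.neg ∈ e.covered ∧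
      absClause (Γ ++ [e]) G = absLit (Γ ++ [e]) K ::ₘ (X + Z) ∧
      absClause (Γ ++ [e]) H₀ = X + Y ∧ ∀ y ∈ Y, ∃ z ∈ Z, litLT (· < ·) y z := by
  have hΓ := h.sound.consistent
  obtain ⟨H, hH, hHf, hle⟩ := hred.exists_false hΓ hG
  have hH' : ¬ FalseG Γ H := by
    obtain ⟨C, hC, hHC⟩ := hH
    exact fun hf => h.noFalse Γ e rfl C hC ⟨H, hHC, hf⟩
  obtain ⟨K, H₀, X, Y, Z, rfl, h1, h2, h3, h4⟩ := hle.exists_last hΓ hHf hG hH'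
  exact ⟨K, H₀, X, Y, Z, hH, hHf, h1, h2, h3, h4⟩

/-- The literal `K` belongs to the smaller clause, but its abstraction occurs in that of `G`; the
last position then identifies a literal of `G` falsified by `e`. -/
theorem Regular.exists_mem_of_redundantG {lt : GAtom S → GAtom S → Prop} {Γ : Trail S}
    {e : Entry S} {N U : Set (Clause S)} {k : ℤ} {s : Indicator S}
    (h : Regular ⟨Γ ++ [e], N, U, k, s⟩) {G : GClause S} (hG : FalseG (Γ ++ [e]) G)
    (hred : RedundantG (inducedLT lt (Γ ++ [e])) (gndSet (N ∪ U)) G) :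
    ∃ K ∈ G, K.neg ∈ e.covered := by
  have hΓ : StronglyConsistent (Γ ++ [e]) := h.sound.consistent
  obtain ⟨K, H₀, X, Y, Z, -, -, hKe, h2, -⟩ := h.exists_last_of_redundantG hG hred
  have hmem : absLit (Γ ++ [e]) K ∈ absClause (Γ ++ [e]) G := h2 ▸ Multiset.mem_cons_self _ _
  obtain ⟨K', hK', heq⟩ := Multiset.mem_map.1 hmem
  refine ⟨K', hK', hΓ.neg_mem_covered_last (hG K' hK') ?_⟩
  rw [← hΓ.absAtom_last (Entry.defines_of_neg_mem hKe)]
  exact congrArg Lit.atom heq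

/-- Clauses that are false without the last element of the trail are not redundant. -/
theorem Regular.not_redundantG_of_falseG {lt : GAtom S → GAtom S → Prop} {Γ : Trail S}
    {e : Entry S} {N U : Set (Clause S)} {k : ℤ} {s : Indicator S}
    (h : Regular ⟨Γ ++ [e], N, U, k, s⟩) {G : GClause S} (hG : FalseG Γ G) :
    ¬ RedundantG (inducedLT lt (Γ ++ [e])) (gndSet (N ∪ U)) G := by
  have hΓ : StronglyConsistent (Γ ++ [e]) := h.sound.consistent
  intro hred
  obtain ⟨K, hK, hKe⟩ := h.exists_mem_of_redundantG (hG.append _) hred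
  exact (hΓ.absAtom_lt_of_falseLit (hG K hK)).ne
    (hΓ.absAtom_last (Entry.defines_of_neg_mem hKe))

/-- Assertive clauses are not redundant. -/
theorem Regular.not_redundantG_of_assertiveG {lt : GAtom S → GAtom S → Prop} {Γ : Trail S}
    {N U : Set (Clause S)} {k : ℤ} {s : Indicator S} (h : Regular ⟨Γ, N, U, k, s⟩) (hk : 0 < k)
    {G : GClause S} (hG : AssertiveG Γ G) :
    ¬ RedundantG (inducedLT lt Γ) (gndSet (N ∪ U)) G := by
  intro hred
  have hΓ : StronglyConsistent Γ := h.sound.consistent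
  have hw : WellFormed Γ N U k := h.sound.wellFormed
  have hlev : decisionLevels Γ ≠ [] := by
    intro h0
    have := hw.count hk.le
    rw [h0] at this
    simp at this
    omega
  obtain ⟨Γ₁, Γ₂, L, π, i, hsplit, h₂⟩ := exists_last_decision hlev
  obtain ⟨hf, K', G₀, rfl, -, hG₀⟩ := hG
  -- All literals of `G` except `K'` are false already before the last decision.
  have hlow : ∀ z ∈ absClause Γ G₀, z.atom < (Γ₁.length : WithTop ℕ) := by
    intro z hz
    obtain ⟨M, hM, rfl⟩ := Multiset.mem_map.1 hz
    have hMf := hf M (Multiset.mem_cons_of_mem hM)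
    have hMl := hG₀ M hM
    have hord := hw.order
    subst hsplit
    exact absAtom_lt_of_not_topLevel hΓ hord h₂ hMf hMl
  have hne : Γ ≠ [] := by rintro rfl; exact hlev rfl
  obtain ⟨Γ', e, hlast⟩ := (List.eq_nil_or_concat' Γ).resolve_left hne
  have hlen : Γ₁.length ≤ Γ'.length := by
    have := congrArg List.length (hsplit.symm.trans hlast)
    simp at this
    omega
  obtain ⟨K, H₀, X, Y, Z, hmem, hHf, hKe, h4, h5, h6⟩ :
      ∃ (K : GLiteral S) (H₀ : GClause S) (X Y Z : Multiset (Lit (WithTop ℕ))),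
      K ::ₘ H₀ ∈ gndSet (N ∪ U) ∧ FalseG Γ (K ::ₘ H₀) ∧
      absAtom Γ K.atom = (Γ'.length : WithTop ℕ) ∧
      absClause Γ (K' ::ₘ G₀) = absLit Γ K ::ₘ (X + Z) ∧
      absClause Γ H₀ = X + Y ∧ ∀ y ∈ Y, ∃ z ∈ Z, litLT (· < ·) y z := by
    subst hlast
    obtain ⟨K, H₀, X, Y, Z, h1, h2, h3, h4⟩ := h.exists_last_of_redundantG hf hred
    exact ⟨K, H₀, X, Y, Z, h1, h2, hΓ.absAtom_last (Entry.defines_of_neg_mem h3), h4⟩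
  -- `K` sits at the last position of the trail, which is not before the last decision, so its
  -- abstraction can only match that of `K'`.
  have hK'eq : absLit Γ K = absLit Γ K' := by
    have hm : absLit Γ K ∈ absClause Γ (K' ::ₘ G₀) := h4 ▸ Multiset.mem_cons_self _ _
    rw [absClause, Multiset.map_cons, Multiset.mem_cons] at hm
    refine hm.resolve_right fun hm' => ?_
    have := hlow _ hm'
    change absAtom Γ K.atom < _ at this
    rw [hKe, Nat.cast_lt] at this
    omega
  rw [absClause, Multiset.map_cons, hK'eq, Multiset.cons_inj_right] at h4
  change absClause Γ G₀ = X + Z at h4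
  rw [h4] at hlow
  -- After cancelling the top literals, the rest of the smaller clause is either shared with `G₀` or
  -- dominated by literals of `G₀`, so it also lies before the last decision.
  have hHlow : ∀ y ∈ X + Y, y.atom < (Γ₁.length : WithTop ℕ) := by
    intro y hy
    rcases Multiset.mem_add.1 hy with hy | hy
    · exact hlow y (Multiset.mem_add.2 (Or.inl hy))
    · obtain ⟨z, hz, hlt⟩ := h6 y hy
      have hz' := hlow z (Multiset.mem_add.2 (Or.inr hz))
      rcases hlt with hlt | ⟨heq, -⟩
      · exact hlt.trans hz'
      · rwa [heq]
  subst hsplit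
  have hH₀ : FalseG Γ₁ H₀ := fun M hM =>
    hΓ.falseLit_of_absAtom_lt (hHf M (Multiset.mem_cons_of_mem hM))
      (hHlow (absLit _ M) (by rw [← h5]; exact Multiset.mem_map_of_mem _ hM))
  have hundef : ¬ DefinedAtom Γ₁ K.atom := by
    rintro ⟨e', he', hd⟩
    obtain ⟨m, hm, rfl⟩ := List.getElem_of_mem he'
    have := hΓ.absAtom_eq (i := m) (e := Γ₁[m])
      (by rw [List.getElem?_append_left hm, List.getElem?_eq_getElem hm]) hd
    rw [hKe, Nat.cast_inj] at this
    omega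
  -- Hence Propagate had an instance just before the last decision, against regularity.
  obtain ⟨C, M, σ, π', hp⟩ := exists_propagateCond hmem hH₀ hundef
  exact h.exhausted Γ₁ Γ₂ L π i rfl C M σ π' hp

/-- Conflict clauses for a last decision that are neither assertive nor factorizable are not
redundant. -/
theorem Regular.not_redundantG_of_not_factorize {lt : GAtom S → GAtom S → Prop} {Γ : Trail S}
    {L : Literal S} {π' : Constraint S} {n : ℕ} {N U : Set (Clause S)} {k : ℤ} {s : Indicator S}
    {C : Clause S} {σ : Subst S} {π : Constraint S}
    (h : Regular ⟨Γ ++ [.decision L π' n], N, U, k, s⟩) (hk : 0 < k)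
    (hna : ¬ Assertive (Γ ++ [.decision L π' n]) (clauseSubst σ C) π)
    (hnf : ¬ ∃ s : State S,
      Factorize ⟨Γ ++ [.decision L π' n], N, U, k, .conflict C σ π⟩ s)
    {G : GClause S} (hf : FalseG (Γ ++ [.decision L π' n]) G)
    (hG : G ∈ gndClause (clauseSubst σ C) π)
    (hsame : ∀ K₁ ∈ G, ∀ K₂ ∈ G, K₁.neg ∈ gndLit L π' → K₂.neg ∈ gndLit L π' → K₁ = K₂) :
    ¬ RedundantG (inducedLT lt (Γ ++ [.decision L π' n])) (gndSet (N ∪ U)) G := by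
  intro hred
  have hΓ : StronglyConsistent (Γ ++ [.decision L π' n]) := h.sound.consistent
  have hw : WellFormed (Γ ++ [.decision L π' n]) N U k := h.sound.wellFormed
  obtain ⟨K, hK, hKe⟩ := h.exists_mem_of_redundantG hf hred
  obtain ⟨G₀, rfl⟩ := Multiset.exists_cons_of_mem hK
  -- A second occurrence falsified by the decision equals `K` by `hsame` and permits Factorize;
  -- without one, `K` is the only top-level literal and `G` is assertive.
  by_cases htwo : ∃ K' ∈ G₀, K'.neg ∈ gndLit L π'
  · obtain ⟨K', hK', hK'e⟩ := htwo
    obtain rfl := hsame K hK K' (Multiset.mem_cons_of_mem hK') hKe hK'e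
    obtain ⟨G₁, rfl⟩ := Multiset.exists_cons_of_mem hK'
    obtain ⟨δ, hδ, hδG⟩ := hG
    exact hnf (factorize_of_duplicate hδ hδG.symm hKe)
  · have hn : n ∈ decisionLevels (Γ ++ [.decision L π' n]) := by
      rw [decisionLevels_append]; exact List.mem_append_right _ (List.mem_singleton.2 rfl)
    refine hna ⟨_, hG, hf, K, G₀, rfl, ?_, ?_⟩ <;> rw [trailLevel_eq hw.order rfl]
    · exact ⟨Γ, [], _, rfl, Entry.defines_of_neg_mem hKe, lastLevel_eq rfl⟩
    · intro K' hK'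
      refine not_litHasLevel_of_absAtom_lt hΓ hw.order (hw.level_bounds hk.le hn).1 ?_
      exact hΓ.absAtom_lt_of_falseLit ((falseLit_concat.1
        (hf K' (Multiset.mem_cons_of_mem hK'))).resolve_right fun h => htwo ⟨K', hK', h⟩)

end NRCL

/-! ### The case analysis at Backjump -/

theorem mainTheorem1 (S : NRCL.Signature.{u, v}) [Nonempty S.Const]
    (lt : NRCL.GAtom S → NRCL.GAtom S → Prop) [IsWellOrder (NRCL.GAtom S) lt]
    (st : ℕ → NRCL.State S) (rule : ℕ → NRCL.Rule) (len : ℕ∞)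
    (hrun : NRCL.IsRegularRun st rule len)
    (i j : ℕ) (hij : i < j) (hj : (j : ℕ∞) < len)
    (hconf : rule i = NRCL.Rule.conflict) (hback : rule j = NRCL.Rule.backjump)
    (hbetween : ∀ l, i < l → l < j → rule l ≠ NRCL.Rule.backjump)
    (C : NRCL.Clause S) (σ : NRCL.Subst S) (π : NRCL.Constraint S)
    (hlearn : (st j).ind = NRCL.Indicator.conflict C σ π) :
    ¬ NRCL.Redundant (NRCL.inducedLT lt (st i).trail) ((st i).N ∪ (st i).U) C := by
  open NRCL in
  have hlt : ∀ l, l ≤ j → (l : ℕ∞) < len := fun l hl =>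
    lt_of_le_of_lt (by exact_mod_cast hl) hj
  have hstep := hrun.steps i (hlt i hij.le)
  have hnf : ¬ Applicable .failure (st i) :=
    hrun.not_applicable (hlt i hij.le) (by rw [hconf]; simp [before])
      (by rw [hconf]; simp [beforeAlt])
  have hreg := hrun.regular i (hlt i hij.le)
  rw [hconf] at hstep
  change Conflict (st i) (st (i + 1)) at hstep
  obtain ⟨Γ, N, U, k, hst, hk⟩ : ∃ Γ N U k, st i = ⟨Γ, N, U, k, .top⟩ ∧ 0 ≤ k := by
    generalize st i = s, st (i + 1) = s' at hstep
    cases hstep with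
    | mk Γ N U k _ _ _ hk => exact ⟨Γ, N, U, k, rfl, hk⟩
  rw [hst] at hstep hnf hreg ⊢
  have hreg := hreg rfl hk
  have hinv : ∀ l, i < l → l ≤ j → IsConflictState Γ N U k (st l) := by
    intro l hil
    induction l, hil using Nat.le_induction with
    | base => exact fun _ => isConflictState_of_conflict hreg.sound.wellFormed hstep
    | succ l hl ih =>
      exact fun hlj => (ih (by omega)).step hreg.sound.wellFormed
        (hbetween l (by omega) (by omega)) (hrun.steps l (hlt l (by omega)))
  -- `Δ` is the part of the trail that Skip has removed between Conflict and Backjump.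
  obtain ⟨Γ', Δ, C', σ', π', hstj, rfl, hf, hne, hdec⟩ := hinv j hij le_rfl
  have hbj := hrun.steps j hj
  rw [hback, hstj] at hbj
  rw [hstj] at hlearn
  cases hlearn
  obtain ⟨Γ₁, Γ₂, rfl, hcond⟩ : ∃ Γ₁ Γ₂, Γ' = Γ₁ ++ Γ₂ ∧ BackjumpCond Γ₁ Γ₂ N U k C σ π := by
    generalize hs : (State.mk Γ' N U k (.conflict C σ π)) = s, st (j + 1) = s' at hbj
    cases hbj with
    | mk Γ₁ Γ₂ _ _ _ _ _ _ _ _ _ _ hc => cases hs; exact ⟨Γ₁, Γ₂, rfl, hc⟩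
  intro hred
  change Redundant (inducedLT lt (Γ₁ ++ Γ₂ ++ Δ)) (N ∪ U) C at hred
  rcases hcond with ⟨-, rfl⟩ | hcond
  -- A constant is needed here: without ground substitutions the empty clause would have no ground
  -- instance.
  · refine not_redundantG_zero ?_ (not_inducedLT_zero lt _)
      (hred 0 ⟨fun _ => Classical.arbitrary _, rfl⟩)
    rintro ⟨D, hD, δ, hδ⟩
    obtain rfl : D = 0 := Multiset.map_eq_zero.1 hδ.symm
    exact hnf ⟨_, Failure.mk _ _ _ _ hD⟩
  have hk0 : 0 < k := by rcases hcond with h | h <;> exact h.1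
  -- If nothing was skipped, the conditions of Backjump speak about the full trail at Conflict;
  -- otherwise its last element `e` is gone and the learned instance is false without it.
  rcases List.eq_nil_or_concat' Δ with rfl | ⟨Δ', e, rfl⟩
  · rw [List.append_nil] at hreg hred
    rcases hcond with ⟨-, ⟨G, hG, hGa⟩, -⟩ | ⟨-, ⟨Γ₃, L, πd, h₃⟩, hna, hnfac, -⟩
    · exact hreg.not_redundantG_of_assertiveG hk0 hGa (hred G (gndClause_subset_gnd _ _ _ hG))
    · generalize trailLevel (Γ₁ ++ Γ₂) = n at h₃
      have hΓ : Γ₁ ++ Γ₂ = (Γ₁ ++ Γ₃) ++ [.decision L πd n] := by rw [h₃, List.append_assoc]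
      rw [List.append_nil] at hdec
      rw [hΓ] at hna hnfac hf hred hreg hdec
      obtain ⟨G, hG⟩ := hne
      exact hreg.not_redundantG_of_not_factorize hk0 hna hnfac (hf G hG) hG
        (hdec rfl _ L πd n rfl G hG) (hred G (gndClause_subset_gnd _ _ _ hG))
  · obtain ⟨G, hG⟩ := hne
    have hGf := (hf G hG).append Δ'
    rw [← List.append_assoc] at hreg hred
    exact hreg.not_redundantG_of_falseG hGf (hred G (gndClause_subset_gnd _ _ _ hG))
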